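/- Let $M$ be a complete connected smooth Riemannian manifold (without boundary), with Riemannian volume measure $dv$, let $\sigma\in M$, and let $B_\sigma(R)$ be the geodesic ball of radius $R$ about $\sigma$. Let $w\in L^1_{loc}(M)$ with $w\ge 0$ almost everywhere, and put $W(R)=\int_{B_\sigma(R)} w\,dv$. Assume that $W$ has zero entropy, that is, $$\limsup_{R\to\infty}\frac{\ln W(R)}{R}=0,$$ where a function $W$ that vanishes identically is also counted as having zero entropy. For an open set $U\subseteq M$, let $W^{1,2}_0(U)$ be the closure of the smooth functions with compact support in $U$ for the norm $\left(\int_U\psi^2\,dv+\int_U|\nabla\psi|^2\,dv\right)^{1/2}$. Integrals of nonnegative functions are understood in $[0,\infty]$. (1) If for some constant $C>0$ $$\int_M w\psi^2\,dv\le C\int_M w|\nabla\psi|^2\,dv\qquad\text{for all }\psi\in W^{1,2}_0(M),$$ then $w=0$ almost everywhere on $M$. (2) If for some constant $C>0$ and some compact set $K\subseteq M$ $$\int_{M\setminus K} w\psi^2\,dv\le C\int_{M\setminus K} w|\nabla\psi|^2\,dv\qquad\text{for all }\psi\in W^{1,2}_0(M\setminus K),$$ then $\int_M w\,dv<\infty$.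 -/

import Mathlib

open scoped Manifold ContDiff ENNReal Topology Bundle
open MeasureTheory Filter Set Bundle

noncomputable section

/-! ### Riemannian geometry: metric coefficients, volume measure, gradient -/

section Riemannian

variable {n : ℕ} {M : Type*} [TopologicalSpace M] [ChartedSpace (EuclideanSpace ℝ (Fin n)) M]
  [RiemannianBundle (fun x : M => TangentSpace (𝓡 n) x)]

/-- The coordinate vector field `∂ᵢ` of the chart around `c`, as a tangent vector at the point of
`M` whose coordinates are `y`. -/
def coordVector (c : M) (y : EuclideanSpace ℝ (Fin n)) (i : Fin n) :
    TangentSpace (𝓡 n) ((chartAt (EuclideanSpace ℝ (Fin n)) c).symm y) :=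
  mfderiv (𝓡 n) (𝓡 n) (chartAt (EuclideanSpace ℝ (Fin n)) c).symm y (EuclideanSpace.single i 1)

/-- The matrix `gᵢⱼ(y) = ⟨∂ᵢ, ∂ⱼ⟩` of the Riemannian metric in the chart around `c`. -/
def metricMatrix (c : M) (y : EuclideanSpace ℝ (Fin n)) : Matrix (Fin n) (Fin n) ℝ :=
  Matrix.of fun i j => inner ℝ (coordVector c y i) (coordVector c y j)

/-- The measure `√(det gᵢⱼ) dy` of the chart around `c`, transported to `M`. It is supported in
the domain of that chart. -/
def chartVolume [MeasurableSpace M] (c : M) : Measure M :=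
  Measure.map (chartAt (EuclideanSpace ℝ (Fin n)) c).symm
    (((volume : Measure (EuclideanSpace ℝ (Fin n))).restrict
        (chartAt (EuclideanSpace ℝ (Fin n)) c).target).withDensity
      fun y => ENNReal.ofReal (Real.sqrt (metricMatrix c y).det))

variable (n M) in
/-- The Riemannian volume measure: the least measure that dominates `√(det gᵢⱼ) dy` in every
preferred chart. As the measures of two charts agree on the overlap of their domains (change of
variables), it is the measure that is given by `√(det gᵢⱼ) dy` in each of these charts. -/
def riemannianVolume [MeasurableSpace M] : Measure M :=
  ⨆ c : M, chartVolume (n := n) c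

/-- The Riemannian gradient `∇f` at `x`: the tangent vector with `⟨∇f, v⟩ = df(v)` for all `v`. -/
def riemannianGradient (f : M → ℝ) (x : M) : TangentSpace (𝓡 n) x :=
  haveI : FiniteDimensional ℝ (TangentSpace (𝓡 n) x) :=
    inferInstanceAs (FiniteDimensional ℝ (EuclideanSpace ℝ (Fin n)))
  haveI : CompleteSpace (TangentSpace (𝓡 n) x) := FiniteDimensional.complete ℝ _
  (InnerProductSpace.toDual ℝ (TangentSpace (𝓡 n) x)).symm (mfderiv (𝓡 n) 𝓘(ℝ, ℝ) f x)

theorem inner_riemannianGradient (f : M → ℝ) (x : M) (v : TangentSpace (𝓡 n) x) :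
    inner ℝ (riemannianGradient f x) v = (mfderiv (𝓡 n) 𝓘(ℝ, ℝ) f x v : ℝ) := by
  have : FiniteDimensional ℝ (TangentSpace (𝓡 n) x) :=
    inferInstanceAs (FiniteDimensional ℝ (EuclideanSpace ℝ (Fin n)))
  have : CompleteSpace (TangentSpace (𝓡 n) x) := FiniteDimensional.complete ℝ _
  exact InnerProductSpace.toDual_symm_apply

end Riemannian

/-! ### The Sobolev space `W₀^{1,2}` -/

section Sobolev

variable {n : ℕ} {M : Type*} [TopologicalSpace M] [ChartedSpace (EuclideanSpace ℝ (Fin n)) M]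
  [RiemannianBundle (fun x : M => TangentSpace (𝓡 n) x)] [MeasurableSpace M]

/-- The vector field `X` is (almost everywhere) measurable on `U`: in every chart, its components
are measurable functions. -/
def AEMeasurableVectorField (U : Set M) (X : (x : M) → TangentSpace (𝓡 n) x) : Prop :=
  ∀ c : M, AEMeasurable
    (fun x => (mfderiv (𝓡 n) (𝓡 n) (chartAt (EuclideanSpace ℝ (Fin n)) c) x (X x) :
      EuclideanSpace ℝ (Fin n)))
    ((riemannianVolume n M).restrict (U ∩ (chartAt (EuclideanSpace ℝ (Fin n)) c).source))

/-- `ψ` belongs to `W₀^{1,2}(U)` and `X` is its gradient. Here `W₀^{1,2}(U)` is the closure of the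
smooth functions with compact support in `U` for the norm `(∫_U ψ² + ∫_U |∇ψ|²)^{1/2}`, and the
gradient of an element of the closure is the `L²` limit of the gradients of approximating
functions (this determines `X` almost everywhere on `U`). -/
structure IsSobolevZero (U : Set M) (ψ : M → ℝ) (X : (x : M) → TangentSpace (𝓡 n) x) : Prop where
  aemeasurable : AEMeasurable ψ ((riemannianVolume n M).restrict U)
  aemeasurable_grad : AEMeasurableVectorField U X
  exists_approx : ∃ f : ℕ → M → ℝ,
    (∀ k, ContMDiff (𝓡 n) 𝓘(ℝ, ℝ) ∞ (f k) ∧ HasCompactSupport (f k) ∧ tsupport (f k) ⊆ U) ∧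
    Tendsto (fun k => ∫⁻ x in U, ‖f k x - ψ x‖ₑ ^ 2 ∂(riemannianVolume n M)) atTop (𝓝 0) ∧
    Tendsto (fun k => ∫⁻ x in U, ‖riemannianGradient (f k) x - X x‖ₑ ^ 2 ∂(riemannianVolume n M))
      atTop (𝓝 0)

/-- The weighted inequality `∫_U w ψ² ≤ C ∫_U w |∇ψ|²` for all `ψ ∈ W₀^{1,2}(U)`, as an inequality
in `[0, ∞]`; it is used for `w ≥ 0`. -/
def WeightedPoincare (w : M → ℝ) (C : ℝ) (U : Set M) : Prop :=
  ∀ (ψ : M → ℝ) (X : (x : M) → TangentSpace (𝓡 n) x), IsSobolevZero U ψ X →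
    ∫⁻ x in U, ENNReal.ofReal (w x * ψ x ^ 2) ∂(riemannianVolume n M) ≤
      ENNReal.ofReal C * ∫⁻ x in U, ENNReal.ofReal (w x * ‖X x‖ ^ 2) ∂(riemannianVolume n M)

end Sobolev

/-! ### Entropy -/

/-- The entropy `limsup_{r → ∞} (ln W(r)) / r` of a nonnegative function, with `ln 0 = -∞`. -/
def growthEntropy (W : ℝ → ℝ≥0∞) : EReal :=
  limsup (fun r : ℝ => ENNReal.log (W r) / (r : EReal)) atTop

/-- `W` has zero entropy. The zero function, for which `ln W` is not a real number, is included. -/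
def HasZeroEntropy (W : ℝ → ℝ≥0∞) : Prop :=
  growthEntropy W = 0 ∨ ∀ r, W r = 0

end

/-!
# Weighted Poincaré inequalities and zero entropy

Let `W(r)` be the integral of `w` over the ball of radius `r` about `σ`. A cutoff function `ψ` that
equals `1` on this ball, vanishes outside the ball of radius `r + 2` and has `|∇ψ| ≤ A` turns the
weighted inequality into `W(r) ≤ C A² (W(r + 2) - W(r))`. Hence
`W(r + 2) ≥ (1 + 1 / (C A²)) W(r)`, and `W` grows exponentially unless it vanishes; zero entropy
rules out exponential growth. If the inequality only holds outside a compact set `K`, then `ψ` is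
also cut off near `K`. This adds a constant
`C A² W(a + 2)`, where `K` lies in the closed ball of radius `a`, and the same iteration bounds
the mass outside the ball of radius `a + 2` by this constant (`le_mul_of_growth`,
`WeightedPoincare.exists_withDensity_compl_ball_le`). The global statement is the case `K = ∅`,
`a = -2`, in which the constant is zero. Zero entropy also makes every `W(r)` finite.

The constant `A` must not depend on `r`, and `ψ` has to be smooth with compact support. Compact
support comes from the Hopf–Rinow theorem: a complete Riemannian manifold is proper
(`IsRiemannianManifold.properSpace`). Smooth cutoff functions with a universal gradient bound are
obtained in `exists_contMDiff_cutoff` by smoothing a `1`-Lipschitz function of the distance: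

* around each point there is a chart in which the metric is comparable, up to the factor `2`, to a
  constant seminorm `v ↦ ‖L v‖` (`exists_ball_norm_mfderiv_extChartAt`), so that convolution with a
  bump function yields local approximations with `|∇f| ≤ 4`, arbitrarily close to the given
  function (`exists_nhds_contMDiffOn_approx`);
* a partition of unity glues finitely many of these. As `∑ ∇ρᵢ = 0`, the derivatives of the `ρᵢ`
  only enter through `∑ (fᵢ - u) ∇ρᵢ`, which is small if the `fᵢ` are close enough to `u`
  (`exists_contMDiff_approx_of_lipschitz`).

A smooth function with compact support in `U`, together with its gradient, belongs to
`W₀^{1,2}(U)`; what has to be checked is that the gradient is a measurable vector field, and it is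
in fact continuous in charts (`continuousOn_mfderiv_extChartAt_riemannianGradient`).
-/

/-! ### Hopf–Rinow theorem -/

/-- A complete locally compact metric space in which every distance `< a + b` can be split, up to
an arbitrarily small error, into steps of lengths `a` and `b`, is proper (Hopf–Rinow–Cohn-Vossen).
The closed ball whose radius is the supremum of the radii of compact balls is totally bounded, as it
lies in small neighborhoods of smaller compact balls, and a neighborhood of a compact ball contains
a larger ball. -/
theorem properSpace_of_approx_between {X : Type*} [MetricSpace X] [CompleteSpace X]
    [LocallyCompactSpace X]
    (h : ∀ (x y : X) (a b : ℝ), 0 ≤ a → 0 < b → dist x y < a + b →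
      ∃ z, dist x z ≤ a ∧ dist z y < b) : ProperSpace X := by
  refine ⟨fun σ R => ?_⟩
  by_contra hR
  set A : Set ℝ := {r | IsCompact (Metric.closedBall σ r)} with hA
  have hdown : ∀ r ∈ A, ∀ s ≤ r, s ∈ A := fun r hr s hs =>
    IsCompact.of_isClosed_subset hr Metric.isClosed_closedBall
      (Metric.closedBall_subset_closedBall hs)
  have h0 : (0 : ℝ) ∈ A := by simp [hA]
  have hbdd : BddAbove A := ⟨R, fun r hr => by
    by_contra! hlt
    exact hR (hdown r hr R hlt.le)⟩
  set ρ := sSup A with hρ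
  have hρ0 : 0 ≤ ρ := le_csSup hbdd h0
  have hρA : IsCompact (Metric.closedBall σ ρ) := by
    refine TotallyBounded.isCompact_of_isClosed ?_ Metric.isClosed_closedBall
    refine Metric.totallyBounded_iff.2 fun ε hε => ?_
    obtain ⟨r₁, hr₁A, hr₁⟩ := exists_lt_of_lt_csSup ⟨0, h0⟩
      (show ρ - ε / 3 < sSup A by rw [← hρ]; linarith)
    obtain ⟨r, hrA, hr0, hr⟩ : ∃ r ∈ A, 0 ≤ r ∧ ρ - ε / 3 < r := by
      rcases le_total 0 r₁ with h1 | h1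
      · exact ⟨r₁, hr₁A, h1, hr₁⟩
      · exact ⟨0, h0, le_rfl, hr₁.trans_le h1⟩
    obtain ⟨t, ht, hcov⟩ := Metric.totallyBounded_iff.1
      (show IsCompact (Metric.closedBall σ r) from hrA).totallyBounded (ε / 3) (by positivity)
    refine ⟨t, ht, fun y hy => ?_⟩
    rw [Metric.mem_closedBall, dist_comm] at hy
    obtain ⟨z, hz, hzy⟩ := h σ y r (ε / 3) hr0 (by positivity) (by linarith)
    have hz' := hcov (show z ∈ Metric.closedBall σ r by rwa [Metric.mem_closedBall, dist_comm])
    simp only [mem_iUnion, Metric.mem_ball, exists_prop] at hz' ⊢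
    obtain ⟨q, hq, hzq⟩ := hz'
    refine ⟨q, hq, ?_⟩
    have := dist_triangle y z q
    rw [dist_comm y z] at this
    linarith
  obtain ⟨K, hK, hsub⟩ := exists_compact_superset hρA
  obtain ⟨δ, hδ, hthick⟩ := hρA.exists_thickening_subset_open isOpen_interior hsub
  have : ρ + δ / 2 ∈ A := by
    refine IsCompact.of_isClosed_subset hK Metric.isClosed_closedBall fun y hy => ?_
    rw [Metric.mem_closedBall, dist_comm] at hy
    obtain ⟨z, hz, hzy⟩ := h σ y ρ δ hρ0 hδ (by linarith)
    refine interior_subset (hthick (Metric.mem_thickening_iff.2 ⟨z, ?_, by rwa [dist_comm]⟩))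
    rwa [Metric.mem_closedBall, dist_comm]
  have := le_csSup hbdd this
  linarith

section
variable {E : Type*} [NormedAddCommGroup E] [NormedSpace ℝ E]
  {H : Type*} [TopologicalSpace H] (I : ModelWithCorners ℝ E H)

/-- On a path of length `< a + b` from `x` to `y`, a point at distance `a` from `x` has distance
`< b` from `y`. -/
theorem IsRiemannianManifold.exists_dist_le_dist_lt {M : Type*} [MetricSpace M]
    [ChartedSpace H M] [RiemannianBundle (fun x : M => TangentSpace I x)]
    [IsRiemannianManifold I M] (x y : M) {a b : ℝ} (ha : 0 ≤ a) (hb : 0 < b)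
    (hxy : dist x y < a + b) : ∃ z, dist x z ≤ a ∧ dist z y < b := by
  rcases le_or_gt (dist x y) a with h | h
  · exact ⟨y, h, by simpa using hb⟩
  have h1 : Manifold.riemannianEDist I x y < ENNReal.ofReal (a + b) := by
    rw [← IsRiemannianManifold.out (I := I) x y, edist_dist]
    exact (ENNReal.ofReal_lt_ofReal_iff (by linarith)).2 hxy
  obtain ⟨γ, h0, h1', hγ, hlen⟩ := Manifold.exists_lt_of_riemannianEDist_lt h1
  have hcont : ContinuousOn (fun t => dist x (γ t)) (Icc 0 1) :=
    (continuous_const.dist continuous_id).comp_continuousOn hγ.continuousOn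
  obtain ⟨t, ht, hta⟩ : a ∈ (fun t => dist x (γ t)) '' Icc 0 1 := by
    refine intermediate_value_Icc zero_le_one hcont ⟨?_, ?_⟩
    · simpa [h0] using ha
    · simpa [h1'] using h.le
  refine ⟨γ t, hta.le, ?_⟩
  have e1 : edist x (γ t) ≤ Manifold.pathELength I γ 0 t := by
    rw [IsRiemannianManifold.out (I := I)]
    exact Manifold.riemannianEDist_le_pathELength (hγ.mono (Icc_subset_Icc_right ht.2)) h0 rfl ht.1
  have e2 : edist (γ t) y ≤ Manifold.pathELength I γ t 1 := by
    rw [IsRiemannianManifold.out (I := I)]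
    exact Manifold.riemannianEDist_le_pathELength (hγ.mono (Icc_subset_Icc_left ht.1)) rfl h1' ht.2
  have e3 : edist x (γ t) + edist (γ t) y < ENNReal.ofReal (a + b) :=
    ((add_le_add e1 e2).trans_eq (Manifold.pathELength_add ht.1 ht.2)).trans_lt hlen
  rw [edist_dist, edist_dist, ← ENNReal.ofReal_add dist_nonneg dist_nonneg,
    ENNReal.ofReal_lt_ofReal_iff (by linarith)] at e3
  simp only at hta
  linarith

/-- The Hopf–Rinow theorem: in a complete Riemannian manifold, closed balls are compact. -/
theorem IsRiemannianManifold.properSpace (M : Type*) [MetricSpace M]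
    [ChartedSpace H M] [RiemannianBundle (fun x : M => TangentSpace I x)]
    [IsRiemannianManifold I M] [CompleteSpace M] [LocallyCompactSpace M] :
    ProperSpace M :=
  properSpace_of_approx_between fun x y _ _ ha hb h => exists_dist_le_dist_lt I x y ha hb h

end

/-! ### Mollification -/

section
open scoped Convolution
variable {E : Type*} [NormedAddCommGroup E] [NormedSpace ℝ E] [FiniteDimensional ℝ E]

/-- Mollification of a function that is Lipschitz on a ball with respect to a translation invariant
gauge `p` (not necessarily the norm of `E`): the approximation satisfies the same bound by `p`, on
a smaller ball. -/
theorem exists_contDiff_approx_of_le (U : E → ℝ) (p : E → ℝ) (y₀ : E) {r R C ε : ℝ}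
    (hr : r < R) (hU : ContinuousOn U (Metric.ball y₀ R))
    (hU1 : ∀ y ∈ Metric.ball y₀ R, |U y| ≤ 1)
    (hC : 0 ≤ C) (hp : ∀ v, p v ≤ C * ‖v‖)
    (hUp : ∀ y ∈ Metric.ball y₀ R, ∀ y' ∈ Metric.ball y₀ R, |U y - U y'| ≤ p (y - y'))
    (hε : 0 < ε) :
    ∃ F : E → ℝ, ContDiff ℝ ∞ F ∧ (∀ y ∈ Metric.ball y₀ r, |F y - U y| ≤ ε) ∧
      ∀ y ∈ Metric.ball y₀ r, ∀ y' ∈ Metric.ball y₀ r, |F y - F y'| ≤ p (y - y') := by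
  borelize E
  set μ : Measure E := Measure.addHaar
  set δ : ℝ := min (R - r) (ε / (C + 1)) with hδ
  have hδ0 : 0 < δ := lt_min (by linarith) (by positivity)
  let φ : ContDiffBump (0 : E) := ⟨δ / 2, δ, by positivity, by linarith⟩
  -- extended by zero, `U` is locally integrable on the whole space
  set U' : E → ℝ := (Metric.ball y₀ R).indicator U with hU'
  have hmeas : AEStronglyMeasurable U' μ :=
    (aestronglyMeasurable_indicator_iff Metric.isOpen_ball.measurableSet).2
      (hU.aestronglyMeasurable Metric.isOpen_ball.measurableSet)
  have hbd : ∀ y, ‖U' y‖ ≤ 1 := fun y => by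
    by_cases hy : y ∈ Metric.ball y₀ R
    · simpa [hU', hy] using hU1 y hy
    · simp [hU', hy]
  have hloc : LocallyIntegrable U' μ :=
    (locallyIntegrable_const (1 : ℝ)).mono hmeas (by simpa using Eventually.of_forall hbd)
  have hmem : ∀ y ∈ Metric.ball y₀ r, ∀ z ∈ Metric.ball (0 : E) δ, y - z ∈ Metric.ball y₀ R := by
    intro y hy z hz
    rw [mem_ball_iff_norm] at hy ⊢
    rw [mem_ball_zero_iff] at hz
    have := norm_sub_le (y - y₀) z
    have h2 : δ ≤ R - r := min_le_left _ _
    rw [show y - z - y₀ = y - y₀ - z by abel]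
    linarith
  have hmem0 : ∀ y ∈ Metric.ball y₀ r, y ∈ Metric.ball y₀ R := fun y hy =>
    Metric.ball_subset_ball hr.le hy
  refine ⟨(φ.normed μ) ⋆[ContinuousLinearMap.lsmul ℝ ℝ, μ] U', ?_, ?_, ?_⟩
  · exact φ.hasCompactSupport_normed.contDiff_convolution_left _ φ.contDiff_normed hloc
  · intro y hy
    have key := φ.dist_normed_convolution_le (μ := μ) (x₀ := y) (ε := ε) hmeas (fun x hx => by
      have hx' : ‖x - y‖ < δ := by simpa only [mem_ball_iff_norm] using hx
      have hxR : x ∈ Metric.ball y₀ R := by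
        have := hmem y hy (y - x) (by rw [mem_ball_zero_iff, norm_sub_rev]; exact hx')
        simpa using this
      rw [hU', indicator_of_mem hxR, indicator_of_mem (hmem0 y hy), Real.dist_eq]
      refine (hUp x hxR y (hmem0 y hy)).trans ((hp _).trans ?_)
      have h2 : δ ≤ ε / (C + 1) := min_le_right _ _
      rw [le_div_iff₀ (by positivity)] at h2
      nlinarith [norm_nonneg (x - y)])
    rwa [Real.dist_eq, hU', indicator_of_mem (hmem0 y hy)] at key
  · intro y hy y' hy'
    have hint : ∀ y, Integrable (fun z => φ.normed μ z • U' (y - z)) μ := fun y =>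
      (φ.hasCompactSupport_normed.convolutionExists_left (ContinuousLinearMap.lsmul ℝ ℝ)
        φ.continuous_normed hloc y)
    simp only [convolution_def, ContinuousLinearMap.lsmul_apply]
    rw [← integral_sub (hint y) (hint y'), ← Real.norm_eq_abs]
    have : p (y - y') = ∫ z, φ.normed μ z * p (y - y') ∂μ := by
      rw [integral_mul_const, φ.integral_normed, one_mul]
    rw [this]
    refine norm_integral_le_of_norm_le (φ.integrable_normed.mul_const _)
      (Eventually.of_forall fun z => ?_)
    rw [← smul_sub, norm_smul, Real.norm_of_nonneg (φ.nonneg_normed z), Real.norm_eq_abs]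
    by_cases hz : z ∈ Metric.ball (0 : E) δ
    · refine mul_le_mul_of_nonneg_left ?_ (φ.nonneg_normed z)
      rw [hU', indicator_of_mem (hmem y hy z hz), indicator_of_mem (hmem y' hy' z hz)]
      simpa using hUp _ (hmem y hy z hz) _ (hmem y' hy' z hz)
    · have : φ.normed μ z = 0 := by
        rw [← Function.notMem_support, φ.support_normed_eq]; exact hz
      simp [this]
end

/-! ### Distortion of the metric in a chart -/

section
variable {n : ℕ} {M : Type*}

theorem isContinuousRiemannianBundle_tangentSpace [TopologicalSpace M]
    [ChartedSpace (EuclideanSpace ℝ (Fin n)) M] [IsManifold (𝓡 n) ∞ M]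
    [RiemannianBundle (fun x : M => TangentSpace (𝓡 n) x)]
    [h : IsContMDiffRiemannianBundle (𝓡 n) ∞ (EuclideanSpace ℝ (Fin n))
      (fun x : M => TangentSpace (𝓡 n) x)] :
    IsContinuousRiemannianBundle (EuclideanSpace ℝ (Fin n))
      (fun x : M => TangentSpace (𝓡 n) x) := by
  obtain ⟨g, hg, hg'⟩ := h.exists_contMDiff
  exact ⟨g, hg.continuous, hg'⟩

/-- Near the center `c` of a chart, the Riemannian norm is comparable, up to the factor `2`, to
the fixed seminorm `‖L v‖` of the coordinate expression. The map `L` identifies the model space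
with the tangent space at `c`. -/
theorem exists_ball_norm_mfderiv_extChartAt [TopologicalSpace M]
    [ChartedSpace (EuclideanSpace ℝ (Fin n)) M] [IsManifold (𝓡 n) ∞ M]
    [RiemannianBundle (fun x : M => TangentSpace (𝓡 n) x)]
    [IsContMDiffRiemannianBundle (𝓡 n) ∞ (EuclideanSpace ℝ (Fin n))
      (fun x : M => TangentSpace (𝓡 n) x)] (c : M) :
    ∃ (R : ℝ) (L : EuclideanSpace ℝ (Fin n) →L[ℝ] TangentSpace (𝓡 n) c), 0 < R ∧
      Metric.ball (extChartAt (𝓡 n) c c) R ⊆ (extChartAt (𝓡 n) c).target ∧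
      ∀ x ∈ (extChartAt (𝓡 n) c).source,
        extChartAt (𝓡 n) c x ∈ Metric.ball (extChartAt (𝓡 n) c c) R →
        ∀ v : TangentSpace (𝓡 n) x,
          ‖L (mfderiv (𝓡 n) 𝓘(ℝ, EuclideanSpace ℝ (Fin n)) (extChartAt (𝓡 n) c) x v)‖
            ≤ 2 * ‖v‖ ∧
          ‖v‖ ≤ 2 * ‖L (mfderiv (𝓡 n) 𝓘(ℝ, EuclideanSpace ℝ (Fin n))
            (extChartAt (𝓡 n) c) x v)‖ := by
  have : IsManifold (𝓡 n) 1 M := .of_le (n := ∞) (by simp)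
  have := isContinuousRiemannianBundle_tangentSpace (n := n) (M := M)
  let T := trivializationAt (EuclideanSpace ℝ (Fin n)) (fun x : M => TangentSpace (𝓡 n) x) c
  have h1 := eventually_norm_symmL_trivializationAt_self_comp_lt (EuclideanSpace ℝ (Fin n))
    (fun x : M => TangentSpace (𝓡 n) x) c one_lt_two
  have h2 := eventually_norm_symmL_trivializationAt_comp_self_lt (EuclideanSpace ℝ (Fin n))
    (fun x : M => TangentSpace (𝓡 n) x) c one_lt_two
  set e := extChartAt (𝓡 n) c with he
  have hc : 𝓝 c = 𝓝 (e.symm (e c)) := by simp [he]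
  have hcont : ContinuousAt e.symm (e c) := continuousAt_extChartAt_symm c
  have h3 := hcont.preimage_mem_nhds (hc ▸ (h1.and h2))
  obtain ⟨R, hR, hsub⟩ := Metric.mem_nhds_iff.1 (inter_mem h3 (extChartAt_target_mem_nhds (I := 𝓡 n) c))
  refine ⟨R, T.symmL ℝ c, hR, fun y hy => (hsub hy).2, fun x hx hxR v => ?_⟩
  have g := (hsub hxR).1
  rw [mem_preimage, e.left_inv hx] at g
  obtain ⟨g1, g2⟩ := g
  have hx' : x ∈ (chartAt (EuclideanSpace ℝ (Fin n)) c).source := by simpa [he] using hx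
  have hxT : x ∈ T.baseSet := by simpa [T] using hx'
  have hcT : c ∈ T.baseSet := by simp [T]
  rw [← TangentBundle.continuousLinearMapAt_trivializationAt hx']
  constructor
  · refine (ContinuousLinearMap.le_of_opNorm_le _ g1.le v)
  · let u : EuclideanSpace ℝ (Fin n) := T.continuousLinearMapAt ℝ x v
    have h4 : ‖T.symmL ℝ x (T.continuousLinearMapAt ℝ c (T.symmL ℝ c u))‖
        ≤ 2 * ‖T.symmL ℝ c u‖ := ContinuousLinearMap.le_of_opNorm_le _ g2.le (T.symmL ℝ c u)
    rw [T.continuousLinearMapAt_symmL hcT, T.symmL_continuousLinearMapAt hxT] at h4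
    exact h4

/-- The Riemannian distance of two points of a chart is at most the length of the coordinate
segment between them. -/
theorem dist_extChartAt_symm_le [MetricSpace M]
    [ChartedSpace (EuclideanSpace ℝ (Fin n)) M] [IsManifold (𝓡 n) ∞ M]
    [RiemannianBundle (fun x : M => TangentSpace (𝓡 n) x)]
    [IsRiemannianManifold (𝓡 n) M] {c : M} {R : ℝ}
    {L : EuclideanSpace ℝ (Fin n) →L[ℝ] TangentSpace (𝓡 n) c}
    (hsub : Metric.ball (extChartAt (𝓡 n) c c) R ⊆ (extChartAt (𝓡 n) c).target)
    (hL : ∀ x ∈ (extChartAt (𝓡 n) c).source,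
        extChartAt (𝓡 n) c x ∈ Metric.ball (extChartAt (𝓡 n) c c) R →
        ∀ v : TangentSpace (𝓡 n) x,
          ‖v‖ ≤ 2 * ‖L (mfderiv (𝓡 n) 𝓘(ℝ, EuclideanSpace ℝ (Fin n))
            (extChartAt (𝓡 n) c) x v)‖)
    {y y' : EuclideanSpace ℝ (Fin n)} (hy : y ∈ Metric.ball (extChartAt (𝓡 n) c c) R)
    (hy' : y' ∈ Metric.ball (extChartAt (𝓡 n) c c) R) :
    dist ((extChartAt (𝓡 n) c).symm y) ((extChartAt (𝓡 n) c).symm y') ≤ 2 * ‖L (y' - y)‖ := by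
  have : IsManifold (𝓡 n) 1 M := .of_le (n := ∞) (by simp)
  set e := extChartAt (𝓡 n) c with he
  let η : ℝ → EuclideanSpace ℝ (Fin n) := ContinuousAffineMap.lineMap (R := ℝ) y y'
  set γ := e.symm ∘ η with hγ
  have hη : ∀ t ∈ Icc (0 : ℝ) 1, η t ∈ Metric.ball (e c) R := by
    intro t ht
    have : η t ∈ segment ℝ y y' := by
      rw [segment_eq_image_lineMap]; exact ⟨t, ht, rfl⟩
    exact (convex_ball _ _).segment_subset hy hy' this
  have η_smooth : ContMDiff 𝓘(ℝ, ℝ) 𝓘(ℝ, EuclideanSpace ℝ (Fin n)) 1 η := by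
    rw [contMDiff_iff_contDiff]
    exact ContinuousAffineMap.contDiff _
  have γ_smooth : ContMDiffOn 𝓘(ℝ, ℝ) (𝓡 n) 1 γ (Icc 0 1) :=
    (contMDiffOn_extChartAt_symm c).comp η_smooth.contMDiffOn fun t ht => hsub (hη t ht)
  have hlen : Manifold.riemannianEDist (𝓡 n) (e.symm y) (e.symm y')
      ≤ Manifold.pathELength (𝓡 n) γ 0 1 :=
    Manifold.riemannianEDist_le_pathELength γ_smooth
      (by simp [hγ, η, ContinuousAffineMap.coe_lineMap_eq])
      (by simp [hγ, η, ContinuousAffineMap.coe_lineMap_eq]) zero_le_one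
  rw [← IsRiemannianManifold.out (I := 𝓡 n), Manifold.pathELength_eq_lintegral_mfderivWithin_Icc]
    at hlen
  have hbd : ∀ t ∈ Icc (0 : ℝ) 1, ‖mfderivWithin 𝓘(ℝ, ℝ) (𝓡 n) γ (Icc 0 1) t 1‖ₑ
      ≤ ENNReal.ofReal (2 * ‖L (y' - y)‖) := by
    intro t ht
    have htu : UniqueMDiffWithinAt 𝓘(ℝ, ℝ) (Icc (0 : ℝ) 1) t := by
      rw [uniqueMDiffWithinAt_iff_uniqueDiffWithinAt]
      exact uniqueDiffOn_Icc zero_lt_one t ht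
    have hsrc : γ t ∈ e.source := e.map_target (hsub (hη t ht))
    have heγ : e (γ t) = η t := e.right_inv (hsub (hη t ht))
    have hcomp : mfderivWithin 𝓘(ℝ, ℝ) 𝓘(ℝ, EuclideanSpace ℝ (Fin n)) (e ∘ γ) (Icc 0 1) t =
        (mfderiv (𝓡 n) 𝓘(ℝ, EuclideanSpace ℝ (Fin n)) e (γ t)).comp
          (mfderivWithin 𝓘(ℝ, ℝ) (𝓡 n) γ (Icc 0 1) t) :=
      mfderiv_comp_mfderivWithin t
        (mdifferentiableAt_extChartAt (by simpa [he] using hsrc))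
        (γ_smooth.mdifferentiableOn one_ne_zero t ht) htu
    have hcongr : mfderivWithin 𝓘(ℝ, ℝ) 𝓘(ℝ, EuclideanSpace ℝ (Fin n)) (e ∘ γ) (Icc 0 1) t =
        mfderivWithin 𝓘(ℝ, ℝ) 𝓘(ℝ, EuclideanSpace ℝ (Fin n)) η (Icc 0 1) t :=
      mfderivWithin_congr (fun s hs => e.right_inv (hsub (hη s hs))) heγ
    have hder : mfderivWithin 𝓘(ℝ, ℝ) 𝓘(ℝ, EuclideanSpace ℝ (Fin n)) η (Icc 0 1) t (1 : ℝ)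
        = y' - y := by
      rw [mfderivWithin_eq_fderivWithin]
      have h1 : HasDerivAt η (y' - y) t := by
        simpa [η, ContinuousAffineMap.coe_lineMap_eq] using
          (AffineMap.hasDerivAt_lineMap (a := y) (b := y') (x := t))
      exact h1.hasDerivWithinAt.derivWithin (uniqueDiffOn_Icc zero_lt_one t ht)
    have key := hL (γ t) hsrc (by rw [heγ]; exact hη t ht)
      (mfderivWithin 𝓘(ℝ, ℝ) (𝓡 n) γ (Icc 0 1) t (1 : ℝ))
    have h3 : mfderiv (𝓡 n) 𝓘(ℝ, EuclideanSpace ℝ (Fin n)) e (γ t)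
        (mfderivWithin 𝓘(ℝ, ℝ) (𝓡 n) γ (Icc 0 1) t (1 : ℝ)) = y' - y := by
      rw [← hder, ← hcongr, hcomp]; rfl
    rw [h3] at key
    rw [← ofReal_norm]
    exact ENNReal.ofReal_le_ofReal key
  have h4 : edist (e.symm y) (e.symm y') ≤ ENNReal.ofReal (2 * ‖L (y' - y)‖) := by
    refine hlen.trans ((setLIntegral_mono' measurableSet_Icc hbd).trans ?_)
    simp
  rw [edist_dist] at h4
  exact (ENNReal.ofReal_le_ofReal_iff (by positivity)).1 h4

end

/-! ### Local smoothing of Lipschitz functions -/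

section
variable {n : ℕ} {M : Type*}

theorem norm_riemannianGradient_le [TopologicalSpace M]
    [ChartedSpace (EuclideanSpace ℝ (Fin n)) M]
    [RiemannianBundle (fun x : M => TangentSpace (𝓡 n) x)] {f : M → ℝ} {x : M}
    {D : TangentSpace (𝓡 n) x →L[ℝ] ℝ} (hD : HasMFDerivAt (𝓡 n) 𝓘(ℝ, ℝ) f x D) {C : ℝ}
    (hC : 0 ≤ C) (h : ∀ v, |D v| ≤ C * ‖v‖) : ‖riemannianGradient (n := n) f x‖ ≤ C := by
  have h1 := inner_riemannianGradient (n := n) f x (riemannianGradient f x)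
  rw [hD.mfderiv, real_inner_self_eq_norm_sq] at h1
  have h2 : ‖riemannianGradient (n := n) f x‖ ^ 2 ≤ C * ‖riemannianGradient (n := n) f x‖ :=
    h1.trans_le ((le_abs_self _).trans (h _))
  by_contra! hlt
  nlinarith

theorem inner_riemannianGradient_eq [TopologicalSpace M]
    [ChartedSpace (EuclideanSpace ℝ (Fin n)) M]
    [RiemannianBundle (fun x : M => TangentSpace (𝓡 n) x)] {f : M → ℝ} {x : M}
    {D : TangentSpace (𝓡 n) x →L[ℝ] ℝ} (hD : HasMFDerivAt (𝓡 n) 𝓘(ℝ, ℝ) f x D)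
    (v : TangentSpace (𝓡 n) x) : inner ℝ (riemannianGradient (n := n) f x) v = D v := by
  rw [inner_riemannianGradient, hD.mfderiv]
  rfl

theorem hasMFDerivAt_of_eventuallyEq_comp_extChartAt [TopologicalSpace M]
    [ChartedSpace (EuclideanSpace ℝ (Fin n)) M] [IsManifold (𝓡 n) ∞ M] {c x : M}
    (hx : x ∈ (extChartAt (𝓡 n) c).source) {f : M → ℝ} {F : EuclideanSpace ℝ (Fin n) → ℝ}
    (hfF : f =ᶠ[𝓝 x] F ∘ extChartAt (𝓡 n) c)
    (hF : DifferentiableAt ℝ F (extChartAt (𝓡 n) c x)) :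
    HasMFDerivAt (𝓡 n) 𝓘(ℝ, ℝ) f x ((fderiv ℝ F (extChartAt (𝓡 n) c x)).comp
      (mfderiv (𝓡 n) 𝓘(ℝ, EuclideanSpace ℝ (Fin n)) (extChartAt (𝓡 n) c) x :
        TangentSpace (𝓡 n) x →L[ℝ] EuclideanSpace ℝ (Fin n))) := by
  have : IsManifold (𝓡 n) 1 M := .of_le (n := ∞) (by simp)
  refine HasMFDerivAt.congr_of_eventuallyEq ?_ hfF
  exact HasMFDerivAt.comp x hF.hasFDerivAt.hasMFDerivAt
    (mdifferentiableAt_extChartAt (by simpa using hx)).hasMFDerivAt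

/-- A `1`-Lipschitz function on a Riemannian manifold has, locally, arbitrarily close smooth
approximations with gradient at most `4`. Neither the bound `4` nor the neighborhood depends on the
precision `ε`. -/
theorem exists_nhds_contMDiffOn_approx [MetricSpace M]
    [ChartedSpace (EuclideanSpace ℝ (Fin n)) M] [IsManifold (𝓡 n) ∞ M]
    [RiemannianBundle (fun x : M => TangentSpace (𝓡 n) x)]
    [IsContMDiffRiemannianBundle (𝓡 n) ∞ (EuclideanSpace ℝ (Fin n))
      (fun x : M => TangentSpace (𝓡 n) x)]
    [IsRiemannianManifold (𝓡 n) M] {u : M → ℝ} (hu : LipschitzWith 1 u)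
    (hu1 : ∀ x, |u x| ≤ 1) (c : M) :
    ∃ V : Set M, IsOpen V ∧ c ∈ V ∧ ∀ ε : ℝ, 0 < ε → ∃ f : M → ℝ,
      ContMDiffOn (𝓡 n) 𝓘(ℝ, ℝ) ∞ f V ∧ (∀ x ∈ V, |f x - u x| ≤ ε) ∧
      ∀ x ∈ V, ‖riemannianGradient (n := n) f x‖ ≤ 4 := by
  obtain ⟨R, L, hR, hsub, hL⟩ := exists_ball_norm_mfderiv_extChartAt (n := n) c
  set e := extChartAt (𝓡 n) c with he
  have hVo : IsOpen (e.source ∩ e ⁻¹' Metric.ball (e c) (R / 2)) :=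
    isOpen_extChartAt_preimage' c Metric.isOpen_ball
  refine ⟨_, hVo, ⟨mem_extChartAt_source c, Metric.mem_ball_self (by positivity)⟩, fun ε hε => ?_⟩
  have hLip : ∀ y ∈ Metric.ball (e c) R, ∀ y' ∈ Metric.ball (e c) R,
      |(u ∘ e.symm) y - (u ∘ e.symm) y'| ≤ 2 * ‖L (y - y')‖ := by
    intro y hy y' hy'
    have h1 := hu.dist_le_mul (e.symm y') (e.symm y)
    have h2 := dist_extChartAt_symm_le hsub (fun x hx hx' v => (hL x hx hx' v).2) hy' hy
    rw [dist_comm, Real.dist_eq, NNReal.coe_one, one_mul] at h1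
    exact h1.trans h2
  obtain ⟨F, hF, hFu, hFL⟩ := exists_contDiff_approx_of_le (u ∘ e.symm) (fun v => 2 * ‖L v‖) (e c)
    (r := R / 2) (R := R) (C := 2 * ‖L‖) (ε := ε) (by linarith)
    (hu.continuous.comp_continuousOn ((continuousOn_extChartAt_symm c).mono hsub))
    (fun y _ => hu1 _) (by positivity)
    (fun v => by have := L.le_opNorm v; linarith) hLip hε
  refine ⟨F ∘ e, ?_, ?_, ?_⟩
  · exact hF.contMDiff.comp_contMDiffOn (contMDiffOn_extChartAt.mono fun x hx => by
      simpa [he] using hx.1)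
  · rintro x ⟨hx, hxR⟩
    simpa [e.left_inv hx] using hFu (e x) hxR
  · rintro x ⟨hx, hxR⟩
    have hxR' : e x ∈ Metric.ball (e c) R := Metric.ball_subset_ball (by linarith) hxR
    have hdF : ∀ y ∈ Metric.ball (e c) (R / 2), ∀ w, |fderiv ℝ F y w| ≤ 2 * ‖L w‖ := by
      intro y hy w
      have h1 : HasDerivAt (fun t : ℝ => F (y + t • w)) (fderiv ℝ F y w) 0 := by
        have h2 : HasDerivAt (fun t : ℝ => y + t • w) w 0 := by
          simpa using ((hasDerivAt_id (0 : ℝ)).smul_const w).const_add y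
        have h3 : HasFDerivAt F (fderiv ℝ F y) (y + (0 : ℝ) • w) := by
          simpa using (hF.differentiable (by simp) y).hasFDerivAt
        exact h3.comp_hasDerivAt 0 h2
      have hnear : ∀ᶠ t : ℝ in 𝓝 0, y + t • w ∈ Metric.ball (e c) (R / 2) := by
        have : Continuous fun t : ℝ => y + t • w := by fun_prop
        exact this.continuousAt.preimage_mem_nhds
          (Metric.isOpen_ball.mem_nhds (by simpa using hy))
      have := h1.le_of_lip' (C := 2 * ‖L w‖) (by positivity) (hnear.mono fun t ht => by
        have := hFL _ ht y hy
        simp only [add_sub_cancel_left, map_smul, norm_smul] at this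
        simp only [zero_smul, add_zero, sub_zero]
        rw [Real.norm_eq_abs, Real.norm_eq_abs]
        rw [Real.norm_eq_abs] at this
        linarith)
      simpa using this
    refine norm_riemannianGradient_le (hasMFDerivAt_of_eventuallyEq_comp_extChartAt hx (F := F)
      EventuallyEq.rfl (hF.differentiable (by simp) _)) (by norm_num) fun v => ?_
    have h1 := hdF (e x) hxR (mfderiv (𝓡 n) 𝓘(ℝ, EuclideanSpace ℝ (Fin n)) e x v)
    have h2 := (hL x hx hxR' v).1
    exact h1.trans (by linarith)

theorem exists_norm_riemannianGradient_le_of_isCompact [TopologicalSpace M]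
    [ChartedSpace (EuclideanSpace ℝ (Fin n)) M] [IsManifold (𝓡 n) ∞ M]
    [RiemannianBundle (fun x : M => TangentSpace (𝓡 n) x)]
    [IsContMDiffRiemannianBundle (𝓡 n) ∞ (EuclideanSpace ℝ (Fin n))
      (fun x : M => TangentSpace (𝓡 n) x)]
    {f : M → ℝ} (hf : ContMDiff (𝓡 n) 𝓘(ℝ, ℝ) ∞ f) {S : Set M} (hS : IsCompact S) :
    ∃ B : ℝ, 0 ≤ B ∧ ∀ x ∈ S, ‖riemannianGradient (n := n) f x‖ ≤ B := by
  have : IsManifold (𝓡 n) 1 M := .of_le (n := ∞) (by simp)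
  have := isContinuousRiemannianBundle_tangentSpace (n := n) (M := M)
  refine hS.induction_on (p := fun S => ∃ B : ℝ, 0 ≤ B ∧
    ∀ x ∈ S, ‖riemannianGradient (n := n) f x‖ ≤ B) ⟨0, le_rfl, by simp⟩ ?_ ?_ ?_
  · rintro s t hst ⟨B, hB, h⟩
    exact ⟨B, hB, fun x hx => h x (hst hx)⟩
  · rintro s t ⟨B, hB, h⟩ ⟨B', hB', h'⟩
    refine ⟨max B B', le_max_of_le_left hB, ?_⟩
    rintro x (hx | hx)
    · exact (h x hx).trans (le_max_left _ _)
    · exact (h' x hx).trans (le_max_right _ _)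
  · intro c hc
    set e := extChartAt (𝓡 n) c with he
    have hFat : ∀ y ∈ e.target, ContDiffAt ℝ ∞ (f ∘ e.symm) y := fun y hy => by
      have hF : ContDiffOn ℝ ∞ (f ∘ e.symm) e.target := by
        rw [← contMDiffOn_iff_contDiffOn]
        exact hf.comp_contMDiffOn (contMDiffOn_extChartAt_symm c)
      exact hF.contDiffAt ((isOpen_extChartAt_target c).mem_nhds hy)
    have hcF : ContinuousAt (fun x => ‖fderiv ℝ (f ∘ e.symm) (e x)‖) c :=
      (ContinuousAt.comp (g := fderiv ℝ (f ∘ e.symm))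
        ((hFat (e c) (mem_extChartAt_target c)).continuousAt_fderiv (by simp))
        (continuousAt_extChartAt c)).norm
    obtain ⟨C, hC, hCe⟩ := eventually_norm_trivializationAt_lt (EuclideanSpace ℝ (Fin n))
      (fun x : M => TangentSpace (𝓡 n) x) c
    set A := ‖fderiv ℝ (f ∘ e.symm) (e c)‖ + 1 with hA
    have hA0 : 0 ≤ A := by positivity
    refine ⟨_, mem_nhdsWithin_of_mem_nhds (((hcF.eventually_lt_const
      (show _ < A by rw [hA]; linarith)).and hCe).and (extChartAt_source_mem_nhds (I := 𝓡 n) c)),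
      A * C, by positivity, ?_⟩
    rintro x ⟨⟨h1, h2⟩, hx⟩
    refine norm_riemannianGradient_le (hasMFDerivAt_of_eventuallyEq_comp_extChartAt hx
      (F := f ∘ e.symm) ?_ ((hFat _ (e.map_source hx)).differentiableAt (by simp)))
      (by positivity) fun v => ?_
    · filter_upwards [(isOpen_extChartAt_source c).mem_nhds hx] with z hz
      exact congrArg f (e.left_inv hz).symm
    · have h3 := ContinuousLinearMap.le_of_opNorm_le _ h2.le v
      rw [TangentBundle.continuousLinearMapAt_trivializationAt 
        (by rwa [← extChartAt_source (𝓡 n)])] at h3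
      refine (ContinuousLinearMap.le_opNorm (fderiv ℝ (f ∘ e.symm) (e x)) _).trans ?_
      rw [mul_assoc]
      exact mul_le_mul h1.le h3 (norm_nonneg _) hA0
end

/-! ### Calculus of gradients -/

section
variable {n : ℕ} {M : Type*} [TopologicalSpace M]
    [ChartedSpace (EuclideanSpace ℝ (Fin n)) M]
    [RiemannianBundle (fun x : M => TangentSpace (𝓡 n) x)]

theorem abs_le_norm_riemannianGradient_mul {f : M → ℝ} {x : M}
    {D : TangentSpace (𝓡 n) x →L[ℝ] ℝ} (hD : HasMFDerivAt (𝓡 n) 𝓘(ℝ, ℝ) f x D)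
    (v : TangentSpace (𝓡 n) x) : |D v| ≤ ‖riemannianGradient (n := n) f x‖ * ‖v‖ := by
  rw [← inner_riemannianGradient_eq hD]
  exact abs_real_inner_le_norm _ _

theorem riemannianGradient_congr {f g : M → ℝ} {x : M} (h : f =ᶠ[𝓝 x] g) :
    riemannianGradient (n := n) f x = riemannianGradient g x := by
  refine ext_inner_right ℝ fun v => ?_
  rw [inner_riemannianGradient, inner_riemannianGradient, h.mfderiv_eq]
  rfl

theorem riemannianGradient_eq_zero_of_eventually_const {f : M → ℝ} {x : M} {a : ℝ}
    (h : ∀ᶠ y in 𝓝 x, f y = a) : riemannianGradient (n := n) f x = 0 := by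
  rw [← norm_le_zero_iff]
  have hD : HasMFDerivAt (𝓡 n) 𝓘(ℝ, ℝ) f x (0 : TangentSpace (𝓡 n) x →L[ℝ] ℝ) :=
    (hasMFDerivAt_const a x).congr_of_eventuallyEq h
  exact norm_riemannianGradient_le hD le_rfl (by simp)

theorem norm_riemannianGradient_add_le {f g : M → ℝ} {x : M}
    (hf : MDifferentiableAt (𝓡 n) 𝓘(ℝ, ℝ) f x) (hg : MDifferentiableAt (𝓡 n) 𝓘(ℝ, ℝ) g x) :
    ‖riemannianGradient (n := n) (fun y => f y + g y) x‖ ≤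
      ‖riemannianGradient (n := n) f x‖ + ‖riemannianGradient (n := n) g x‖ := by
  set Df : TangentSpace (𝓡 n) x →L[ℝ] ℝ := mfderiv (𝓡 n) 𝓘(ℝ, ℝ) f x with hDf
  set Dg : TangentSpace (𝓡 n) x →L[ℝ] ℝ := mfderiv (𝓡 n) 𝓘(ℝ, ℝ) g x with hDg
  have hf' : HasMFDerivAt (𝓡 n) 𝓘(ℝ, ℝ) f x Df := hf.hasMFDerivAt
  have hg' : HasMFDerivAt (𝓡 n) 𝓘(ℝ, ℝ) g x Dg := hg.hasMFDerivAt
  have h : HasMFDerivAt (𝓡 n) 𝓘(ℝ, ℝ) (fun y => f y + g y) x (Df + Dg) := hf'.add hg'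
  refine norm_riemannianGradient_le h (by positivity) fun v => ?_
  have h1 := abs_le_norm_riemannianGradient_mul hf' v
  have h2 := abs_le_norm_riemannianGradient_mul hg' v
  have h3 := abs_add_le (Df v) (Dg v)
  rw [add_apply]
  linarith

theorem norm_riemannianGradient_mul_le {f g : M → ℝ} {x : M}
    (hf : MDifferentiableAt (𝓡 n) 𝓘(ℝ, ℝ) f x) (hg : MDifferentiableAt (𝓡 n) 𝓘(ℝ, ℝ) g x) :
    ‖riemannianGradient (n := n) (fun y => f y * g y) x‖ ≤
      |f x| * ‖riemannianGradient (n := n) g x‖ + |g x| * ‖riemannianGradient (n := n) f x‖ := by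
  set Df : TangentSpace (𝓡 n) x →L[ℝ] ℝ := mfderiv (𝓡 n) 𝓘(ℝ, ℝ) f x with hDf
  set Dg : TangentSpace (𝓡 n) x →L[ℝ] ℝ := mfderiv (𝓡 n) 𝓘(ℝ, ℝ) g x with hDg
  have hf' : HasMFDerivAt (𝓡 n) 𝓘(ℝ, ℝ) f x Df := hf.hasMFDerivAt
  have hg' : HasMFDerivAt (𝓡 n) 𝓘(ℝ, ℝ) g x Dg := hg.hasMFDerivAt
  have h : HasMFDerivAt (𝓡 n) 𝓘(ℝ, ℝ) (fun y => f y * g y) x (f x • Dg + g x • Df) :=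
    hf'.mul hg'
  refine norm_riemannianGradient_le h (by positivity) fun v => ?_
  have h1 := mul_le_mul_of_nonneg_left (abs_le_norm_riemannianGradient_mul hf' v) (abs_nonneg (g x))
  have h2 := mul_le_mul_of_nonneg_left (abs_le_norm_riemannianGradient_mul hg' v) (abs_nonneg (f x))
  have h3 := abs_add_le (f x * Dg v) (g x * Df v)
  rw [abs_mul, abs_mul] at h3
  change |f x * Dg v + g x * Df v| ≤ _
  linarith

theorem norm_riemannianGradient_comp_le {f : M → ℝ} {χ : ℝ → ℝ} {x : M}
    (hf : MDifferentiableAt (𝓡 n) 𝓘(ℝ, ℝ) f x) (hχ : DifferentiableAt ℝ χ (f x)) :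
    ‖riemannianGradient (n := n) (χ ∘ f) x‖ ≤
      |deriv χ (f x)| * ‖riemannianGradient (n := n) f x‖ := by
  set Df : TangentSpace (𝓡 n) x →L[ℝ] ℝ := mfderiv (𝓡 n) 𝓘(ℝ, ℝ) f x with hDf
  have hf' : HasMFDerivAt (𝓡 n) 𝓘(ℝ, ℝ) f x Df := hf.hasMFDerivAt
  have h : HasMFDerivAt (𝓡 n) 𝓘(ℝ, ℝ) (χ ∘ f) x ((fderiv ℝ χ (f x)).comp Df) :=
    HasMFDerivAt.comp x hχ.hasFDerivAt.hasMFDerivAt hf'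
  refine norm_riemannianGradient_le h (by positivity) fun v => ?_
  have h1 := mul_le_mul_of_nonneg_left (abs_le_norm_riemannianGradient_mul hf' v)
    (abs_nonneg (deriv χ (f x)))
  rw [ContinuousLinearMap.comp_apply, fderiv_eq_smul_deriv, smul_eq_mul, abs_mul]
  linarith

theorem norm_riemannianGradient_sum_le {ι : Type*} (s : Finset ι) {g : ι → M → ℝ} {x : M}
    (hg : ∀ i ∈ s, MDifferentiableAt (𝓡 n) 𝓘(ℝ, ℝ) (g i) x) :
    MDifferentiableAt (𝓡 n) 𝓘(ℝ, ℝ) (fun y => ∑ i ∈ s, g i y) x ∧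
    ‖riemannianGradient (n := n) (fun y => ∑ i ∈ s, g i y) x‖ ≤
      ∑ i ∈ s, ‖riemannianGradient (n := n) (g i) x‖ := by
  classical
  induction s using Finset.induction_on with
  | empty =>
    simp only [Finset.sum_empty]
    exact ⟨mdifferentiableAt_const, (norm_le_zero_iff.2
      (riemannianGradient_eq_zero_of_eventually_const (a := 0) (by simp)))⟩
  | insert i s hi ih =>
    simp only [Finset.sum_insert hi]
    obtain ⟨h1, h2⟩ := ih fun j hj => hg j (Finset.mem_insert_of_mem hj)
    have h3 := hg i (Finset.mem_insert_self i s)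
    exact ⟨h3.add h1, (norm_riemannianGradient_add_le h3 h1).trans (by gcongr)⟩

end

/-! ### Smooth cutoff functions with bounded gradient -/

section
variable {n : ℕ} {M : Type*} [MetricSpace M] [SecondCountableTopology M]
  [ChartedSpace (EuclideanSpace ℝ (Fin n)) M] [IsManifold (𝓡 n) ∞ M]
  [RiemannianBundle (fun x : M => TangentSpace (𝓡 n) x)]
  [IsContMDiffRiemannianBundle (𝓡 n) ∞ (EuclideanSpace ℝ (Fin n))
      (fun x : M => TangentSpace (𝓡 n) x)]
  [IsRiemannianManifold (𝓡 n) M]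

variable (n) in
/-- A compactly supported `1`-Lipschitz function has a smooth approximation whose gradient on the
support is bounded by an absolute constant. Away from the support, only the upper bound is needed:
the approximation is cut off at small values later on. -/
theorem exists_contMDiff_approx_of_lipschitz {u : M → ℝ} (hu : LipschitzWith 1 u)
    (hu1 : ∀ x, u x ∈ Icc 0 1) (huc : HasCompactSupport u) :
    ∃ f : M → ℝ, ContMDiff (𝓡 n) 𝓘(ℝ, ℝ) ∞ f ∧
      (∀ x ∈ tsupport u, |f x - u x| ≤ 1 / 8 ∧ ‖riemannianGradient (n := n) f x‖ ≤ 5) ∧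
      ∀ x ∉ tsupport u, f x ≤ 1 / 8 := by
  have : LocallyCompactSpace M := ChartedSpace.locallyCompactSpace (EuclideanSpace ℝ (Fin n)) M
  obtain ⟨S, hS, hsub⟩ := exists_compact_superset huc
  have hu1' : ∀ x, |u x| ≤ 1 := fun x => by rw [abs_of_nonneg (hu1 x).1]; exact (hu1 x).2
  choose V hVo hcV hV using exists_nhds_contMDiffOn_approx (n := n) hu hu1'
  obtain ⟨t, -, ht⟩ := hS.elim_nhds_subcover V fun x _ => (hVo x).mem_nhds (hcV x)
  obtain ⟨ρ, hρ⟩ := SmoothPartitionOfUnity.exists_isSubordinate (𝓡 n) hS.isClosed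
    (fun i : t => V i) (fun i => hVo i) (by simpa [iUnion_subtype] using ht)
  choose B hB0 hB using fun i : t =>
    exists_norm_riemannianGradient_le_of_isCompact (ρ i).contMDiff hS
  -- small enough for the error terms `ε ‖∇ρᵢ‖` to add up to at most `1`
  set ε : ℝ := 1 / (8 * (1 + ∑ i, B i)) with hε
  have hBs : 0 ≤ ∑ i, B i := Finset.sum_nonneg fun i _ => hB0 i
  have hε0 : 0 < ε := by positivity
  have hε8 : ε ≤ 1 / 8 := by
    rw [hε]; gcongr; linarith
  have hεB : ε * ∑ i, B i ≤ 1 := by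
    rw [hε, one_div, inv_mul_le_one₀ (by positivity)]; linarith
  choose f hf hfu hfg using fun i : t => hV i ε hε0
  have hnot : ∀ i : t, ∀ x ∉ V i, x ∉ tsupport (ρ i) := fun i x hx h => hx (hρ i h)
  have hρ0 : ∀ i : t, ∀ x ∉ V i, ρ i x = 0 := fun i x hx =>
    image_eq_zero_of_notMem_tsupport (hnot i x hx)
  have hsmooth : ∀ i : t, ContMDiff (𝓡 n) 𝓘(ℝ, ℝ) ∞ fun x => ρ i x * f i x := fun i =>
    ρ.contMDiff_smul fun x hx => (hf i).contMDiffAt ((hVo i).mem_nhds (hρ i hx))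
  have hterm : ∀ i : t, ∀ x, |ρ i x * (f i x - u x)| ≤ ρ i x * ε := by
    intro i x
    rw [abs_mul, abs_of_nonneg (ρ.nonneg i x)]
    by_cases hx : x ∈ V i
    · exact mul_le_mul_of_nonneg_left (hfu i x hx) (ρ.nonneg i x)
    · simp [hρ0 i x hx]
  have hsum1 : ∀ x, ∑ i, ρ i x ≤ 1 := fun x => by
    rw [← finsum_eq_sum_of_fintype]; exact ρ.sum_le_one x
  have hsumS : ∀ x ∈ S, ∑ i, ρ i x = 1 := fun x hx => by
    rw [← finsum_eq_sum_of_fintype]; exact ρ.sum_eq_one hx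
  have hclose : ∀ x, |∑ i, ρ i x * f i x - (∑ i, ρ i x) * u x| ≤ 1 / 8 := by
    intro x
    rw [Finset.sum_mul, ← Finset.sum_sub_distrib]
    calc |∑ i, (ρ i x * f i x - ρ i x * u x)| ≤ ∑ i, |ρ i x * f i x - ρ i x * u x| :=
          Finset.abs_sum_le_sum_abs _ _
      _ ≤ ∑ i, ρ i x * ε := Finset.sum_le_sum fun i _ => by
          rw [← mul_sub]; exact hterm i x
      _ = (∑ i, ρ i x) * ε := by rw [Finset.sum_mul]
      _ ≤ 1 * ε := by gcongr; exact hsum1 x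
      _ ≤ 1 / 8 := by rwa [one_mul]
  refine ⟨fun x => ∑ i, ρ i x * f i x, contMDiff_finsetSum fun i _ => hsmooth i, ?_, ?_⟩
  · intro x hx
    have hxS : x ∈ S := interior_subset (hsub hx)
    refine ⟨by simpa only [hsumS x hxS, one_mul] using hclose x, ?_⟩
    -- subtracting the constant `u x` makes the factors of `∇ρᵢ` at `x` small
    have heq : (fun y => ∑ i, ρ i y * f i y) =ᶠ[𝓝 x]
        fun y => u x + ∑ i, ρ i y * (f i y - u x) := by
      filter_upwards [mem_interior_iff_mem_nhds.1 (hsub hx)] with y hy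
      simp only [mul_sub, Finset.sum_sub_distrib, ← Finset.sum_mul, hsumS y hy]
      ring
    have hsm : ∀ i : t, MDifferentiableAt (𝓡 n) 𝓘(ℝ, ℝ) (fun y => ρ i y * (f i y - u x)) x ∧
        ‖riemannianGradient (n := n) (fun y => ρ i y * (f i y - u x)) x‖ ≤
          ρ i x * 4 + ε * B i := by
      intro i
      by_cases hxV : x ∈ V i
      · have hfd : MDifferentiableAt (𝓡 n) 𝓘(ℝ, ℝ) (f i) x :=
          ((hf i).contMDiffAt ((hVo i).mem_nhds hxV)).mdifferentiableAt (by simp)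
        have hρd : MDifferentiableAt (𝓡 n) 𝓘(ℝ, ℝ) (ρ i) x :=
          (ρ i).contMDiff.mdifferentiableAt (by simp)
        have hcd : MDifferentiableAt (𝓡 n) 𝓘(ℝ, ℝ) (fun _ : M => - u x) x :=
          mdifferentiableAt_const
        have hfd' : MDifferentiableAt (𝓡 n) 𝓘(ℝ, ℝ) (fun y => f i y - u x) x := by
          have h := hfd.add hcd
          simp only [sub_eq_add_neg]
          exact h
        have hg' : ‖riemannianGradient (n := n) (fun y => f i y - u x) x‖ ≤ 4 := by
          have := norm_riemannianGradient_add_le hfd hcd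
          rw [riemannianGradient_eq_zero_of_eventually_const (f := fun _ : M => - u x)
            (a := - u x) (by simp), norm_zero, add_zero] at this
          simpa only [sub_eq_add_neg] using this.trans (hfg i x hxV)
        refine ⟨hρd.mul hfd', (norm_riemannianGradient_mul_le hρd hfd').trans ?_⟩
        rw [abs_of_nonneg (ρ.nonneg i x)]
        have := hfu i x hxV
        have := hB i x hxS
        have := ρ.nonneg i x
        gcongr
      · have h0 : ∀ᶠ y in 𝓝 x, ρ i y * (f i y - u x) = 0 := by
          filter_upwards [(isClosed_tsupport (ρ i)).isOpen_compl.mem_nhds (hnot i x hxV)]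
            with y hy
          rw [image_eq_zero_of_notMem_tsupport hy, zero_mul]
        refine ⟨(mdifferentiableAt_const (c := (0 : ℝ))).congr_of_eventuallyEq h0, ?_⟩
        rw [riemannianGradient_eq_zero_of_eventually_const h0, norm_zero]
        have := ρ.nonneg i x
        have := hB0 i
        positivity
    obtain ⟨h1, h2⟩ := norm_riemannianGradient_sum_le (n := n) Finset.univ
      (g := fun i : t => fun y => ρ i y * (f i y - u x)) (x := x) fun i _ => (hsm i).1
    have hcd : MDifferentiableAt (𝓡 n) 𝓘(ℝ, ℝ) (fun _ : M => u x) x := mdifferentiableAt_const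
    rw [riemannianGradient_congr heq]
    refine (norm_riemannianGradient_add_le hcd h1).trans ?_
    rw [riemannianGradient_eq_zero_of_eventually_const (f := fun _ : M => u x)
            (a := u x) (by simp), norm_zero, zero_add]
    refine h2.trans ((Finset.sum_le_sum fun i _ => (hsm i).2).trans ?_)
    rw [Finset.sum_add_distrib, ← Finset.sum_mul, ← Finset.mul_sum, hsumS x hxS]
    linarith
  · intro x hx
    have h := hclose x
    rw [image_eq_zero_of_notMem_tsupport hx, mul_zero, sub_zero] at h
    exact (le_abs_self _).trans h

variable (n M) in
/-- Smooth counterparts of compactly supported `1`-Lipschitz functions with values in `[0, 1]`: the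
gradient bound `K` does not depend on the function. -/
theorem exists_contMDiff_cutoff : ∃ K : ℝ, 0 < K ∧ ∀ u : M → ℝ, LipschitzWith 1 u →
    (∀ x, u x ∈ Icc 0 1) → HasCompactSupport u → ∃ ψ : M → ℝ, ContMDiff (𝓡 n) 𝓘(ℝ, ℝ) ∞ ψ ∧
      tsupport ψ ⊆ {x | 1 / 8 ≤ u x} ∧ HasCompactSupport ψ ∧ (∀ x, u x = 1 → ψ x = 1) ∧
      ∀ x, ‖riemannianGradient (n := n) ψ x‖ ≤ K := by
  set χ : ℝ → ℝ := fun s => Real.smoothTransition (4 * s - 1) with hχ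
  have hχs : ContDiff ℝ ∞ χ := Real.smoothTransition.contDiff.comp (by fun_prop)
  obtain ⟨A, hA⟩ := (isCompact_Icc (a := (-1 : ℝ)) (b := 2)).exists_bound_of_continuousOn
    (hχs.continuous_deriv (by simp)).continuousOn
  refine ⟨|A| * 5 + 1, by positivity, fun u hu hu1 huc => ?_⟩
  obtain ⟨f, hf, hfu, hfo⟩ := exists_contMDiff_approx_of_lipschitz n hu hu1 huc
  have hχ0 : ∀ s ≤ 1 / 4, χ s = 0 := fun s hs =>
    Real.smoothTransition.zero_of_nonpos (by linarith)
  have hsupp : tsupport (χ ∘ f) ⊆ {x | 1 / 8 ≤ u x} := by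
    refine closure_minimal (fun x hx => ?_) (isClosed_le continuous_const hu.continuous)
    by_contra hlt
    simp only [mem_ofPred_eq, not_le] at hlt
    refine hx (hχ0 _ ?_)
    by_cases hxu : x ∈ tsupport u
    · have := (abs_le.1 (hfu x hxu).1).2
      linarith
    · linarith [hfo x hxu]
  have hsub : {x | 1 / 8 ≤ u x} ⊆ tsupport u := fun x hx => subset_tsupport u (by
    simp only [mem_ofPred_eq] at hx
    simp only [Function.mem_support]
    linarith)
  refine ⟨χ ∘ f, hχs.contMDiff.comp hf, hsupp,
    huc.of_isClosed_subset (isClosed_tsupport _) (hsupp.trans hsub), fun x hx => ?_, fun x => ?_⟩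
  · have := (abs_le.1 (hfu x (hsub (by simp only [mem_ofPred_eq, hx]; norm_num))).1).1
    exact Real.smoothTransition.one_of_one_le (by linarith)
  · by_cases hxu : x ∈ tsupport u
    · obtain ⟨h1, h2⟩ := hfu x hxu
      have h3 := hu1 x
      have h4 := hA (f x) ⟨by linarith [(abs_le.1 h1).1, h3.1], by linarith [(abs_le.1 h1).2, h3.2]⟩
      refine (norm_riemannianGradient_comp_le (hf.mdifferentiableAt (by simp))
        (hχs.differentiable (by simp) _)).trans ?_
      rw [Real.norm_eq_abs] at h4
      have h5 : |deriv χ (f x)| * ‖riemannianGradient (n := n) f x‖ ≤ |A| * 5 :=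
        mul_le_mul (h4.trans (le_abs_self A)) h2 (norm_nonneg _) (abs_nonneg _)
      linarith
    · rw [riemannianGradient_eq_zero_of_eventually_const (a := 0), norm_zero]
      · positivity
      · filter_upwards [(isClosed_tsupport (χ ∘ f)).isOpen_compl.mem_nhds
          fun h => hxu (hsub (hsupp h))] with y hy
        exact image_eq_zero_of_notMem_tsupport hy

end

/-! ### Continuity of the gradient -/

section
variable {n : ℕ} {M : Type*} [TopologicalSpace M]
    [ChartedSpace (EuclideanSpace ℝ (Fin n)) M] [IsManifold (𝓡 n) ∞ M]
    [RiemannianBundle (fun x : M => TangentSpace (𝓡 n) x)]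

/-- The solution of a linear system depends continuously on the system (Cramer's rule). -/
theorem continuousOn_of_mulVec_eq {ι X : Type*} [Fintype ι] [DecidableEq ι] [TopologicalSpace X]
    {s : Set X} {G : X → Matrix ι ι ℝ} {y l : X → ι → ℝ} (hG : ContinuousOn G s)
    (hl : ContinuousOn l s) (hdet : ∀ x ∈ s, (G x).det ≠ 0)
    (h : ∀ x ∈ s, (G x).mulVec (y x) = l x) : ContinuousOn y s := by
  have hY : ∀ x ∈ s, y x = ((G x).det)⁻¹ • (G x).adjugate.mulVec (l x) := by
    intro x hx
    rw [← h x hx, Matrix.mulVec_mulVec, Matrix.adjugate_mul, Matrix.smul_mulVec,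
      Matrix.one_mulVec, smul_smul, inv_mul_cancel₀ (hdet x hx), one_smul]
  have h1 : ContinuousOn (fun x => (G x).det) s :=
    (Continuous.matrix_det continuous_id).comp_continuousOn hG
  have h2 : Continuous fun p : Matrix ι ι ℝ × (ι → ℝ) => p.1.adjugate.mulVec p.2 :=
    continuous_fst.matrix_adjugate.matrix_mulVec continuous_snd
  exact ((h1.inv₀ hdet).smul (h2.comp_continuousOn (hG.prodMk hl))).congr hY

/-- The gradient of a smooth function is continuous in charts: its coordinates `Y` solve `G Y = l`
for the Gram matrix `G` of the coordinate frame and the partial derivatives `l` of the function. -/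
theorem continuousOn_mfderiv_extChartAt_riemannianGradient
    [IsContMDiffRiemannianBundle (𝓡 n) ∞ (EuclideanSpace ℝ (Fin n))
      (fun x : M => TangentSpace (𝓡 n) x)]
    {f : M → ℝ} (hf : ContMDiff (𝓡 n) 𝓘(ℝ, ℝ) ∞ f) (c : M) :
    ContinuousOn (fun x => (mfderiv (𝓡 n) 𝓘(ℝ, EuclideanSpace ℝ (Fin n)) (extChartAt (𝓡 n) c) x
      (riemannianGradient f x) : EuclideanSpace ℝ (Fin n))) (extChartAt (𝓡 n) c).source := by
  have : IsManifold (𝓡 n) 1 M := .of_le (n := ∞) (by simp)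
  have := isContinuousRiemannianBundle_tangentSpace (n := n) (M := M)
  set e := extChartAt (𝓡 n) c with he
  let T := trivializationAt (EuclideanSpace ℝ (Fin n)) (fun x : M => TangentSpace (𝓡 n) x) c
  have hTb : ∀ x ∈ e.source, x ∈ T.baseSet := fun x hx => by simpa [T, he] using hx
  have hTe : ∀ x ∈ e.source, T.continuousLinearMapAt ℝ x =
      mfderiv (𝓡 n) 𝓘(ℝ, EuclideanSpace ℝ (Fin n)) e x := fun x hx =>
    TangentBundle.continuousLinearMapAt_trivializationAt (by simpa [he] using hx)
  let b : Fin n → EuclideanSpace ℝ (Fin n) := fun i => EuclideanSpace.single i 1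
  -- the coordinate frame
  let X : Fin n → (x : M) → TangentSpace (𝓡 n) x := fun i x => T.symmL ℝ x (b i)
  have hX : ∀ i, ContinuousOn (fun x => (X i x : TotalSpace (EuclideanSpace ℝ (Fin n))
      (fun x : M => TangentSpace (𝓡 n) x))) e.source := by
    intro i
    have h1 : ContinuousOn (fun x : M => T.toOpenPartialHomeomorph.symm (x, b i)) e.source := by
      refine T.toOpenPartialHomeomorph.symm.continuousOn.comp (by fun_prop) fun x hx => ?_
      simpa [T.mem_target] using hTb x hx
    refine h1.congr fun x hx => ?_
    refine Eq.trans ?_ (T.mk_symm (hTb x hx) (b i))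
    rw [← T.symmL_apply (R := ℝ) (hTb x hx)]
  let G : M → Matrix (Fin n) (Fin n) ℝ := fun x => Matrix.of fun i j => inner ℝ (X i x) (X j x)
  let l : M → Fin n → ℝ := fun x i => inner ℝ (riemannianGradient f x) (X i x)
  let Y : M → EuclideanSpace ℝ (Fin n) := fun x =>
    T.continuousLinearMapAt ℝ x (riemannianGradient f x)
  have hG : ContinuousOn G e.source := by
    refine continuousOn_pi.2 fun i => continuousOn_pi.2 fun j => ?_
    exact (hX i).inner_bundle (hX j)
  have hl : ContinuousOn l e.source := by
    have hF : ContDiffOn ℝ ∞ (f ∘ e.symm) e.target := by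
      rw [← contMDiffOn_iff_contDiffOn]
      exact hf.comp_contMDiffOn (contMDiffOn_extChartAt_symm c)
    have hto : IsOpen e.target := isOpen_extChartAt_target c
    have hF' : ContinuousOn (fderiv ℝ (f ∘ e.symm)) e.target :=
      hF.continuousOn_fderiv_of_isOpen hto (by simp)
    refine continuousOn_pi.2 fun i => ?_
    have h1 : ContinuousOn (fun x => fderiv ℝ (f ∘ e.symm) (e x) (b i)) e.source :=
      (hF'.comp (continuousOn_extChartAt c) e.mapsTo).clm_apply continuousOn_const
    refine h1.congr fun x hx => ?_
    have hD := hasMFDerivAt_of_eventuallyEq_comp_extChartAt hx (f := f) (F := f ∘ e.symm)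
      (by filter_upwards [(isOpen_extChartAt_source c).mem_nhds hx] with z hz
          exact congrArg f (e.left_inv hz).symm)
      ((hF.contDiffAt (hto.mem_nhds (e.map_source hx))).differentiableAt (by simp))
    have hTX : T.continuousLinearMapAt ℝ x (X i x) = b i :=
      T.continuousLinearMapAt_symmL (hTb x hx) (b i)
    rw [hTe x hx] at hTX
    simp only [l]
    rw [inner_riemannianGradient_eq hD]
    exact congrArg (fderiv ℝ (f ∘ e.symm) (e x)) hTX
  have hexp : ∀ x ∈ e.source, ∀ w : EuclideanSpace ℝ (Fin n),
      T.symmL ℝ x w = ∑ j, w j • X j x := by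
    intro x hx w
    have : w = ∑ j, w j • b j := by
      ext k
      simp [b, Finset.sum_apply, Pi.single_apply]
    conv_lhs => rw [this]
    rw [map_sum]
    simp only [map_smul, X]
  have hGY : ∀ x ∈ e.source, (G x).mulVec (Y x) = l x := by
    intro x hx
    ext i
    have h1 : riemannianGradient f x = ∑ j, (Y x) j • X j x := by
      rw [← hexp x hx, T.symmL_continuousLinearMapAt (hTb x hx)]
    simp only [Matrix.mulVec, dotProduct, G, Matrix.of_apply, l]
    rw [h1, sum_inner]
    refine Finset.sum_congr rfl fun j _ => ?_
    rw [inner_smul_left, real_inner_comm]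
    simp [mul_comm]
  have hdet : ∀ x ∈ e.source, (G x).det ≠ 0 := by
    intro x hx h0
    obtain ⟨w, hw, hGw⟩ := Matrix.exists_mulVec_eq_zero_iff.2 h0
    refine hw ?_
    have h1 : inner ℝ (∑ j, w j • X j x) (∑ j, w j • X j x) = (0 : ℝ) := by
      rw [sum_inner]
      refine Finset.sum_eq_zero fun i _ => ?_
      have h2 := congrFun hGw i
      simp only [Matrix.mulVec, dotProduct, G, Matrix.of_apply, Pi.zero_apply] at h2
      rw [inner_smul_left, inner_sum]
      simp only [inner_smul_right]
      rw [show ∑ j, w j * inner ℝ (X i x) (X j x) = 0 by simpa [mul_comm] using h2, mul_zero]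
    rw [inner_self_eq_zero] at h1
    have h3 := hexp x hx (WithLp.toLp 2 w)
    simp only at h3
    rw [h1] at h3
    have h4 := T.continuousLinearMapAt_symmL (R := ℝ) (hTb x hx) (WithLp.toLp 2 w)
    rw [h3, map_zero] at h4
    simpa using congrArg WithLp.ofLp h4.symm
  have hcont : ContinuousOn Y e.source :=
    (PiLp.continuous_toLp 2 _).comp_continuousOn
      (continuousOn_of_mulVec_eq (y := fun x => (Y x).ofLp) hG hl hdet hGY)
  refine hcont.congr fun x hx => ?_
  exact congrArg (fun D : TangentSpace (𝓡 n) x →L[ℝ] EuclideanSpace ℝ (Fin n) =>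
    D (riemannianGradient f x)) (hTe x hx).symm

end

/-! ### Growth and entropy -/

/-- If `V(r) - D B` were positive for some `r`, it would be multiplied at least by `1 + 1 / D` in
each step `r ↦ r + 2`, which is incompatible with subexponential growth. -/
theorem le_mul_of_growth {V : ℝ → ℝ} (hmono : Monotone V) {D B r₀ : ℝ} (hD : 0 < D)
    (hB : 0 ≤ B)
    (h : ∀ r ≥ r₀, V r ≤ D * (V (r + 2) - V r) + D * B)
    (hsub : ∀ δ > 0, ∀ᶠ r in atTop, V r ≤ Real.exp (δ * r)) (r : ℝ) : V r ≤ D * B := by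
  suffices H : ∀ r ≥ r₀, V r ≤ D * B from
    (hmono (le_max_left r r₀)).trans (H _ (le_max_right _ _))
  intro r hr
  by_contra! hlt
  set X := V r - D * B with hX
  have hX0 : 0 < X := by rw [hX]; linarith
  set q := 1 + 1 / D with hq
  have hq1 : 1 < q := by
    rw [hq]
    have : 0 < 1 / D := by positivity
    linarith
  have hstep : ∀ k : ℕ, q ^ k * X ≤ V (r + 2 * k) - D * B := by
    intro k
    induction k with
    | zero => simp [hX]
    | succ k ih =>
      have h1 := h (r + 2 * k) (by
        have : (0 : ℝ) ≤ 2 * k := by positivity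
        linarith)
      have h2 : q * (V (r + 2 * k) - D * B) ≤ V (r + 2 * k + 2) - D * B := by
        have : (V (r + 2 * k) - D * B) / D ≤ V (r + 2 * k + 2) - V (r + 2 * k) := by
          rw [div_le_iff₀ hD]; linarith
        rw [hq, add_mul, one_mul, one_div_mul_eq_div]
        linarith
      calc q ^ (k + 1) * X = q * (q ^ k * X) := by ring
        _ ≤ q * (V (r + 2 * k) - D * B) := by gcongr
        _ ≤ V (r + 2 * k + 2) - D * B := h2
        _ = V (r + 2 * (k + 1 : ℕ)) - D * B := by push_cast; ring_nf
  -- a rate at which `exp (δ r)` grows only by the factor `√q` in each step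
  set δ := Real.log q / 4 with hδ
  have hδ0 : 0 < δ := div_pos (Real.log_pos hq1) (by norm_num)
  set s := Real.exp (2 * δ) with hs
  have hs1 : 1 < s := Real.one_lt_exp_iff.2 (by positivity)
  have hsq : s ^ 2 = q := by
    rw [hs, ← Real.exp_nat_mul, hδ]
    convert Real.exp_log (show 0 < q by linarith) using 2
    push_cast; ring
  have hlim : Tendsto (fun k : ℕ => r + 2 * (k : ℝ)) atTop atTop :=
    tendsto_atTop_add_const_left _ _ (tendsto_natCast_atTop_atTop.const_mul_atTop (by norm_num))
  have hev := hlim.eventually (hsub δ hδ0)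
  have hbig := (tendsto_pow_atTop_atTop_of_one_lt hs1).eventually_gt_atTop
    ((Real.exp (δ * r)) / X)
  obtain ⟨k, hk1, hk2⟩ := (hev.and hbig).exists
  have hexp : Real.exp (δ * (r + 2 * k)) = Real.exp (δ * r) * s ^ k := by
    rw [hs, ← Real.exp_nat_mul, ← Real.exp_add]; ring_nf
  rw [hexp] at hk1
  have hk3 := hstep k
  rw [← hsq, ← pow_mul, mul_comm 2 k, pow_mul, sq] at hk3
  rw [div_lt_iff₀ hX0] at hk2
  have hsk : 0 < s ^ k := by positivity
  have hDB : 0 ≤ D * B := by positivity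
  have := mul_lt_mul_of_pos_right hk2 hsk
  nlinarith

theorem HasZeroEntropy.eventually_le {W : ℝ → ℝ≥0∞} (hW : HasZeroEntropy W) {δ : ℝ} (hδ : 0 < δ) :
    ∀ᶠ r in atTop, W r ≤ ENNReal.ofReal (Real.exp (δ * r)) := by
  rcases hW with hW | hW
  · have h1 : limsup (fun r : ℝ => ENNReal.log (W r) / (r : EReal)) atTop < (δ : EReal) := by
      rw [growthEntropy] at hW
      rw [hW]; exact_mod_cast hδ
    filter_upwards [eventually_lt_of_limsup_lt h1, eventually_gt_atTop 0] with r hr hr0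
    have h2 : ENNReal.log (W r) ≤ ((δ * r : ℝ) : EReal) := by
      rw [mul_comm, EReal.coe_mul]
      exact (EReal.div_le_iff_le_mul (by exact_mod_cast hr0) (EReal.coe_ne_top r)).1 hr.le
    rwa [← Real.log_exp (δ * r), ← ENNReal.log_ofReal_of_pos (Real.exp_pos _),
      ENNReal.log_le_log_iff] at h2
  · exact Eventually.of_forall fun r => by simp [hW r]

/-! ### Smooth functions in the Sobolev space -/

section
variable {n : ℕ} {M : Type*} [TopologicalSpace M]
    [ChartedSpace (EuclideanSpace ℝ (Fin n)) M] [IsManifold (𝓡 n) ∞ M]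
    [RiemannianBundle (fun x : M => TangentSpace (𝓡 n) x)]
    [IsContMDiffRiemannianBundle (𝓡 n) ∞ (EuclideanSpace ℝ (Fin n))
      (fun x : M => TangentSpace (𝓡 n) x)]
    [MeasurableSpace M] [BorelSpace M]

theorem isSobolevZero_of_contMDiff {U : Set M} {ψ : M → ℝ}
    (hψ : ContMDiff (𝓡 n) 𝓘(ℝ, ℝ) ∞ ψ) (hc : HasCompactSupport ψ) (hs : tsupport ψ ⊆ U) :
    IsSobolevZero (n := n) U ψ (riemannianGradient ψ) where
  aemeasurable := hψ.continuous.measurable.aemeasurable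
  aemeasurable_grad c := by
    have h := continuousOn_mfderiv_extChartAt_riemannianGradient hψ c
    have he : (extChartAt (𝓡 n) c : M → EuclideanSpace ℝ (Fin n)) =
      chartAt (EuclideanSpace ℝ (Fin n)) c := by ext; simp
    have h2 := h.aemeasurable (μ := riemannianVolume n M)
      (isOpen_extChartAt_source c).measurableSet
    rw [extChartAt_source] at h2
    exact h2.mono_measure (Measure.restrict_mono inter_subset_right le_rfl)
  exists_approx := ⟨fun _ => ψ, fun _ => ⟨hψ, hc, hs⟩, by simp, by simp⟩

end

/-! ### Annular cutoff functions -/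

section
variable {n : ℕ} {M : Type*} [MetricSpace M] [ProperSpace M] [SecondCountableTopology M]
  [ChartedSpace (EuclideanSpace ℝ (Fin n)) M] [IsManifold (𝓡 n) ∞ M]
  [RiemannianBundle (fun x : M => TangentSpace (𝓡 n) x)]
  [IsContMDiffRiemannianBundle (𝓡 n) ∞ (EuclideanSpace ℝ (Fin n))
      (fun x : M => TangentSpace (𝓡 n) x)]
  [IsRiemannianManifold (𝓡 n) M]

variable (n M) in
/-- Cutoff functions that are `1` for `a + 2 ≤ d(σ, ·) < r` and that vanish near the closed ball of
radius `a`, with a gradient bound independent of `σ`, `a` and `r`. The gradient vanishes outside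
the ball of radius `a + 2` and the annulus `r ≤ d(σ, ·) < r + 2`. -/
theorem exists_contMDiff_annular_cutoff : ∃ K : ℝ, 0 < K ∧ ∀ (σ : M) (a r : ℝ),
    ∃ ψ : M → ℝ, ContMDiff (𝓡 n) 𝓘(ℝ, ℝ) ∞ ψ ∧ HasCompactSupport ψ ∧
      tsupport ψ ⊆ (Metric.closedBall σ a)ᶜ ∧
      (∀ x ∈ Metric.ball σ r \ Metric.ball σ (a + 2), ψ x = 1) ∧
      (∀ x, ‖riemannianGradient (n := n) ψ x‖ ≤ K) ∧
      ∀ x ∉ (Metric.ball σ (r + 2) \ Metric.ball σ r) ∪ Metric.ball σ (a + 2),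
        riemannianGradient (n := n) ψ x = 0 := by
  obtain ⟨K, hK, H⟩ := exists_contMDiff_cutoff n M
  refine ⟨K, hK, fun σ a r => ?_⟩
  set u : M → ℝ := fun x => max 0 (min 1 (min (dist x σ - a) (r + 2 - dist x σ))) with hu
  have hdist : LipschitzWith 1 fun x : M => dist x σ := LipschitzWith.dist_left σ
  have hL1 : LipschitzWith 1 fun x : M => dist x σ - a := fun x y => by
    simpa using hdist x y
  have hL2 : LipschitzWith 1 fun x : M => r + 2 - dist x σ := fun x y => by
    simpa using hdist x y
  have hL : LipschitzWith 1 u := by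
    have h := ((hL1.min hL2).const_min 1).const_max 0
    simpa using h
  have hu01 : ∀ x, u x ∈ Icc 0 1 := fun x =>
    ⟨le_max_left _ _, max_le zero_le_one (min_le_left _ _)⟩
  have hpos : ∀ x, 0 < u x → a < dist x σ ∧ dist x σ < r + 2 := fun x hx => by
    simp only [hu, lt_max_iff, lt_min_iff, lt_irrefl, false_or] at hx
    exact ⟨by linarith [hx.2.1], by linarith [hx.2.2]⟩
  have hone : ∀ x, a + 1 ≤ dist x σ → dist x σ ≤ r + 1 → u x = 1 := fun x h1 h2 => by
    have : min 1 (min (dist x σ - a) (r + 2 - dist x σ)) = 1 :=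
      min_eq_left (le_min (by linarith) (by linarith))
    simp [hu, this]
  have huc : HasCompactSupport u := by
    refine HasCompactSupport.of_support_subset_isCompact (isCompact_closedBall σ (r + 2))
      fun x hx => ?_
    exact (hpos x ((hu01 x).1.lt_of_ne (Ne.symm hx))).2.le
  obtain ⟨ψ, hψ, hsupp, hψc, hψ1, hψK⟩ := H u hL hu01 huc
  have hlocal : ∀ x, a + 1 < dist x σ → dist x σ < r + 1 →
      riemannianGradient (n := n) ψ x = 0 := fun x h1 h2 => by
    refine riemannianGradient_eq_zero_of_eventually_const (a := 1) ?_
    filter_upwards [hdist.continuous.continuousAt.eventually_const_lt h1,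
      hdist.continuous.continuousAt.eventually_lt_const h2] with y hy1 hy2
    exact hψ1 y (hone y hy1.le hy2.le)
  refine ⟨ψ, hψ, hψc, fun x hx => ?_, fun x hx => ?_, hψK, fun x hx => ?_⟩
  · have h1 : 1 / 8 ≤ u x := hsupp hx
    simpa using (hpos x (by linarith)).1
  · simp only [Set.mem_sdiff, Metric.mem_ball, not_lt] at hx
    exact hψ1 x (hone x (by linarith) (by linarith))
  · simp only [mem_union, Set.mem_sdiff, Metric.mem_ball, not_or, not_and_or, not_lt, not_le] at hx
    obtain ⟨h1 | h1, h2⟩ := hx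
    · refine riemannianGradient_eq_zero_of_eventually_const (a := 0) ?_
      have hx : x ∉ tsupport ψ := fun h => by
        have h3 : 1 / 8 ≤ u x := hsupp h
        linarith [(hpos x (by linarith)).2]
      filter_upwards [(isClosed_tsupport ψ).isOpen_compl.mem_nhds hx] with y hy
      exact image_eq_zero_of_notMem_tsupport hy
    · exact hlocal x (by linarith) (by linarith)

end

/-! ### Mass estimate from the weighted inequality -/

section
variable {n : ℕ} {M : Type*} [MetricSpace M]
  [ChartedSpace (EuclideanSpace ℝ (Fin n)) M] [IsManifold (𝓡 n) ∞ M]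
  [RiemannianBundle (fun x : M => TangentSpace (𝓡 n) x)]
  [IsContMDiffRiemannianBundle (𝓡 n) ∞ (EuclideanSpace ℝ (Fin n))
      (fun x : M => TangentSpace (𝓡 n) x)]
  [MeasurableSpace M] [BorelSpace M]

/-- The weighted inequality for an annular cutoff function: the mass of the annulus
`a + 2 ≤ d(σ, ·) < r` is controlled by the mass of the region where the gradient is nonzero. -/
theorem WeightedPoincare.withDensity_ball_diff_le {w : M → ℝ} {C : ℝ} {K : Set M}
    {A : ℝ} (hP : WeightedPoincare (n := n) w C Kᶜ) {σ : M} {a r : ℝ}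
    (hK : K ⊆ Metric.closedBall σ a) {ψ : M → ℝ} (hψ : ContMDiff (𝓡 n) 𝓘(ℝ, ℝ) ∞ ψ)
    (hψc : HasCompactSupport ψ) (hsupp : tsupport ψ ⊆ (Metric.closedBall σ a)ᶜ)
    (h1 : ∀ x ∈ Metric.ball σ r \ Metric.ball σ (a + 2), ψ x = 1)
    (hA : ∀ x, ‖riemannianGradient (n := n) ψ x‖ ≤ A)
    (h0 : ∀ x ∉ (Metric.ball σ (r + 2) \ Metric.ball σ r) ∪ Metric.ball σ (a + 2),
        riemannianGradient (n := n) ψ x = 0) :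
    (riemannianVolume n M).withDensity (fun x => ENNReal.ofReal (w x))
        (Metric.ball σ r \ Metric.ball σ (a + 2)) ≤
      ENNReal.ofReal C * (ENNReal.ofReal (A ^ 2) *
        (riemannianVolume n M).withDensity (fun x => ENNReal.ofReal (w x))
        ((Metric.ball σ (r + 2) \ Metric.ball σ r) ∪ Metric.ball σ (a + 2))) := by
  have hmT : MeasurableSet (Metric.ball σ r \ Metric.ball σ (a + 2)) :=
    measurableSet_ball.diff measurableSet_ball
  have hmQ : MeasurableSet ((Metric.ball σ (r + 2) \ Metric.ball σ r) ∪ Metric.ball σ (a + 2)) :=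
    (measurableSet_ball.diff measurableSet_ball).union measurableSet_ball
  have hsub : Metric.ball σ r \ Metric.ball σ (a + 2) ⊆ Kᶜ := fun x hx hxK => by
    have := hK hxK
    simp only [Set.mem_sdiff, Metric.mem_ball, not_lt, Metric.mem_closedBall] at hx this
    linarith [hx.2]
  rw [withDensity_apply _ hmT, withDensity_apply _ hmQ]
  calc ∫⁻ x in Metric.ball σ r \ Metric.ball σ (a + 2), ENNReal.ofReal (w x) ∂riemannianVolume n M
      = ∫⁻ x in Metric.ball σ r \ Metric.ball σ (a + 2),
          ENNReal.ofReal (w x * ψ x ^ 2) ∂riemannianVolume n M :=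
        setLIntegral_congr_fun hmT fun x hx => by simp [h1 x hx]
    _ ≤ ∫⁻ x in Kᶜ, ENNReal.ofReal (w x * ψ x ^ 2) ∂riemannianVolume n M :=
        lintegral_mono_set hsub
    _ ≤ ENNReal.ofReal C * ∫⁻ x in Kᶜ, ENNReal.ofReal
          (w x * ‖riemannianGradient (n := n) ψ x‖ ^ 2) ∂riemannianVolume n M :=
        hP ψ _ (isSobolevZero_of_contMDiff hψ hψc (hsupp.trans (compl_subset_compl.2 hK)))
    _ ≤ _ := by
      gcongr
      refine (setLIntegral_le_lintegral _ _).trans ?_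
      rw [← lintegral_const_mul' _ _ ENNReal.ofReal_ne_top, ← lintegral_indicator hmQ]
      refine lintegral_mono fun x => ?_
      by_cases hx : x ∈ (Metric.ball σ (r + 2) \ Metric.ball σ r) ∪ Metric.ball σ (a + 2)
      · rw [indicator_of_mem hx, mul_comm (w x), ENNReal.ofReal_mul (by positivity)]
        gcongr
        exact hA x
      · simp [h0 x hx]

end

section
variable {n : ℕ} {M : Type*} [MetricSpace M] [ProperSpace M] [SecondCountableTopology M]
  [ChartedSpace (EuclideanSpace ℝ (Fin n)) M] [IsManifold (𝓡 n) ∞ M]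
  [RiemannianBundle (fun x : M => TangentSpace (𝓡 n) x)]
  [IsContMDiffRiemannianBundle (𝓡 n) ∞ (EuclideanSpace ℝ (Fin n))
      (fun x : M => TangentSpace (𝓡 n) x)]
  [IsRiemannianManifold (𝓡 n) M]
  [MeasurableSpace M] [BorelSpace M]

/-- Under zero entropy, a weighted Poincaré inequality outside `K` bounds the mass outside a ball
that contains `K` by a multiple of the mass of that ball. -/
theorem WeightedPoincare.exists_withDensity_compl_ball_le {w : M → ℝ} {C : ℝ} {K : Set M}
    (hC : 0 < C) (hP : WeightedPoincare (n := n) w C Kᶜ) {σ : M} {a : ℝ}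
    (hK : K ⊆ Metric.closedBall σ a)
    (hent : HasZeroEntropy
      (fun R => ∫⁻ x in Metric.ball σ R, ENNReal.ofReal (w x) ∂(riemannianVolume n M))) :
    ∃ B : ℝ≥0∞, B ≠ ⊤ ∧
      (riemannianVolume n M).withDensity (fun x => ENNReal.ofReal (w x))
        (Metric.ball σ (a + 2)) < ⊤ ∧
      (riemannianVolume n M).withDensity (fun x => ENNReal.ofReal (w x)) (Metric.ball σ (a + 2))ᶜ ≤
        B * (riemannianVolume n M).withDensity (fun x => ENNReal.ofReal (w x))
          (Metric.ball σ (a + 2)) := by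
  set ν := (riemannianVolume n M).withDensity (fun x => ENNReal.ofReal (w x)) with hν
  obtain ⟨A, hA, hcut⟩ := exists_contMDiff_annular_cutoff n M
  have hsubexp : ∀ δ > 0, ∀ᶠ r in atTop,
      ν (Metric.ball σ r) ≤ ENNReal.ofReal (Real.exp (δ * r)) := by
    intro δ hδ
    filter_upwards [hent.eventually_le hδ] with r hr
    rwa [hν, withDensity_apply _ measurableSet_ball]
  have hfin : ∀ r, ν (Metric.ball σ r) ≠ ⊤ := by
    intro r
    obtain ⟨s, hs, hrs⟩ := ((hsubexp 1 one_pos).and (eventually_ge_atTop r)).exists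
    exact ((measure_mono (Metric.ball_subset_ball hrs)).trans_lt
      (hs.trans_lt ENNReal.ofReal_lt_top)).ne
  set S := Metric.ball σ (a + 2) with hS
  have hfin' : ∀ r, ν (Metric.ball σ r \ S) ≠ ⊤ := fun r =>
    measure_ne_top_of_subset sdiff_subset (hfin r)
  set D : ℝ := C * A ^ 2 with hD
  have hD0 : 0 < D := by positivity
  have hmono : Monotone fun r => ν.real (Metric.ball σ r \ S) := fun r s hrs =>
    measureReal_mono (sdiff_subset_sdiff_left (Metric.ball_subset_ball hrs)) (hfin' s)
  have key : ∀ r, ν.real (Metric.ball σ r \ S) ≤ D * ν.real S := by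
    refine le_mul_of_growth (V := fun r => ν.real (Metric.ball σ r \ S)) (r₀ := a + 2) hmono hD0
      measureReal_nonneg (fun r hr => ?_) fun δ hδ => ?_
    · obtain ⟨ψ, hψ, hψc, hsupp, h1, hAψ, h0⟩ := hcut σ a r
      have h := hP.withDensity_ball_diff_le hK hψ hψc hsupp h1 hAψ h0
      rw [← mul_assoc, ← ENNReal.ofReal_mul hC.le, ← hν, ← hS, ← hD] at h
      have hSr : S ⊆ Metric.ball σ r := Metric.ball_subset_ball hr
      have hd : ν.real (Metric.ball σ (r + 2) \ S) =
          ν.real (Metric.ball σ r \ S) + ν.real (Metric.ball σ (r + 2) \ Metric.ball σ r) := by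
        rw [← measureReal_union (disjoint_sdiff_right.mono_left sdiff_subset)
          (measurableSet_ball.diff measurableSet_ball) (hfin' r)
          (measure_ne_top_of_subset sdiff_subset (hfin _))]
        congr 1
        have hrr : Metric.ball σ r ⊆ Metric.ball σ (r + 2) :=
          Metric.ball_subset_ball (by linarith)
        ext x
        simp only [Set.mem_sdiff, mem_union]
        constructor
        · rintro ⟨hx1, hx2⟩
          by_cases hx : x ∈ Metric.ball σ r
          · exact Or.inl ⟨hx, hx2⟩
          · exact Or.inr ⟨hx1, hx⟩
        · rintro (⟨hx1, hx2⟩ | ⟨hx1, hx2⟩)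
          · exact ⟨hrr hx1, hx2⟩
          · exact ⟨hx1, fun h => hx2 (hSr h)⟩
      have h2 := ENNReal.toReal_mono (ENNReal.mul_ne_top ENNReal.ofReal_ne_top
        ((measure_union_lt_top (measure_ne_top_of_subset sdiff_subset (hfin _)).lt_top
          (hfin _).lt_top).ne)) h
      rw [ENNReal.toReal_mul, ENNReal.toReal_ofReal hD0.le] at h2
      have h3 := measureReal_union_le (μ := ν) (Metric.ball σ (r + 2) \ Metric.ball σ r) S
      have h4 := h2.trans (mul_le_mul_of_nonneg_left h3 hD0.le)
      simp only [hd]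
      change ν.real (Metric.ball σ r \ S) ≤ _ at h4
      linarith
    · filter_upwards [hsubexp δ hδ] with r hr
      exact ENNReal.toReal_le_of_le_ofReal (Real.exp_pos _).le ((measure_mono sdiff_subset).trans hr)
  refine ⟨ENNReal.ofReal D, ENNReal.ofReal_ne_top, (hfin _).lt_top, ?_⟩
  have hU : Sᶜ = ⋃ k : ℕ, Metric.ball σ k \ S := by
    rw [← iUnion_sdiff, Metric.iUnion_ball_nat, compl_eq_univ_sdiff]
  have hmonoN : Monotone fun k : ℕ => Metric.ball σ (k : ℝ) \ S := fun k l hkl =>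
    sdiff_subset_sdiff_left (Metric.ball_subset_ball (by exact_mod_cast hkl))
  rw [hU, hmonoN.measure_iUnion]
  refine iSup_le fun k => ?_
  rw [← ENNReal.ofReal_toReal (hfin' k), ← ENNReal.ofReal_toReal (hfin (a + 2)),
    ← ENNReal.ofReal_mul hD0.le]
  exact ENNReal.ofReal_le_ofReal (key k)

end

theorem theorem5p8 {n : ℕ} {M : Type*} [MetricSpace M] [CompleteSpace M]
    [SecondCountableTopology M]
    [ChartedSpace (EuclideanSpace ℝ (Fin n)) M] [IsManifold (𝓡 n) ∞ M]
    [RiemannianBundle (fun x : M => TangentSpace (𝓡 n) x)]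
    [IsContMDiffRiemannianBundle (𝓡 n) ∞ (EuclideanSpace ℝ (Fin n))
      (fun x : M => TangentSpace (𝓡 n) x)]
    [IsRiemannianManifold (𝓡 n) M]
    [MeasurableSpace M] [BorelSpace M]
    (w : M → ℝ) (hw : LocallyIntegrable w (riemannianVolume n M))
    (hw0 : ∀ᵐ x ∂(riemannianVolume n M), 0 ≤ w x)
    (σ : M)
    (hent : HasZeroEntropy
      (fun R => ∫⁻ x in Metric.ball σ R, ENNReal.ofReal (w x) ∂(riemannianVolume n M))) :
    (∀ C : ℝ, 0 < C → WeightedPoincare (n := n) w C univ →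
      ∀ᵐ x ∂(riemannianVolume n M), w x = 0) ∧
    (∀ C : ℝ, 0 < C → ∀ K : Set M, IsCompact K → WeightedPoincare (n := n) w C Kᶜ →
      ∫⁻ x, ENNReal.ofReal (w x) ∂(riemannianVolume n M) < ⊤) := by
  have : LocallyCompactSpace M := ChartedSpace.locallyCompactSpace (EuclideanSpace ℝ (Fin n)) M
  have : ProperSpace M := IsRiemannianManifold.properSpace (𝓡 n) M
  refine ⟨fun C hC hP => ?_, fun C hC K hK hP => ?_⟩
  · rw [← compl_empty] at hP
    obtain ⟨B, -, -, h⟩ := hP.exists_withDensity_compl_ball_le (a := -2) hC (empty_subset _) hent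
    -- the ball of radius `-2 + 2 = 0` is empty, so that the bound is zero
    rw [neg_add_cancel, Metric.ball_zero, compl_empty, measure_empty, mul_zero, nonpos_iff_eq_zero,
      withDensity_apply _ MeasurableSet.univ, Measure.restrict_univ,
      lintegral_eq_zero_iff' hw.aestronglyMeasurable.aemeasurable.ennreal_ofReal] at h
    filter_upwards [h, hw0] with x hx hx0
    exact le_antisymm (ENNReal.ofReal_eq_zero.1 hx) hx0
  · obtain ⟨a, ha⟩ := hK.isBounded.subset_closedBall σ
    obtain ⟨B, hB, hfin, h⟩ := hP.exists_withDensity_compl_ball_le hC ha hent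
    rw [← setLIntegral_univ, ← withDensity_apply _ MeasurableSet.univ,
      ← measure_add_measure_compl (Metric.isOpen_ball (x := σ) (ε := a + 2)).measurableSet]
    exact ENNReal.add_lt_top.2 ⟨hfin, h.trans_lt (ENNReal.mul_lt_top hB.lt_top hfin)⟩
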